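/- Let $N\ge 1$ be an integer, $\mathbf R^N$ the Euclidean space, $B(z,\sigma)$ the open ball, and let $G(t,x)=(4\pi t)^{-N/2}e^{-|x|^2/(4t)}$ and $e^{t\Delta}\mu(x)=\int_{\mathbf R^N}G(t,x-y)\,d\mu(y)$ for $t>0$. For $0<\alpha<1$ let $$h_\alpha(\theta)=\sum_{k=0}^\infty\frac{(-\theta)^k}{k!\,\Gamma(1-\alpha-\alpha k)},\qquad \theta>0$$ (with $1/\Gamma=0$ at the poles of $\Gamma$), which is the probability density on $(0,\infty)$ with Laplace transform $\int_0^\infty h_\alpha(\theta)e^{-s\theta}\,d\theta=\sum_{k\ge0}(-s)^k/\Gamma(1+\alpha k)$, and set $$P_\alpha(t)\mu=\int_0^\infty h_\alpha(\theta)\,e^{t^\alpha\theta\Delta}\mu\,d\theta,\qquad S_\alpha(t)\mu=\int_0^\infty \theta h_\alpha(\theta)\,e^{t^\alpha\theta\Delta}\mu\,d\theta .$$ For $p>1$, $0<T<\infty$ and a nonnegative Radon measure $\mu$ on $\mathbf R^N$, a nonnegative solution in $[0,T]\times\mathbf R^N$ of the problem $$\partial_t^\alpha u-\Delta u=u^p,\qquad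 u(0)=\mu,$$ where $\partial_t^\alpha$ is the Caputo derivative, is a measurable function $u:(0,T]\times\mathbf R^N\to[0,\infty]$ such that $$\infty>u(t,x)=[P_\alpha(t)\mu](x)+\alpha\int_0^t(t-s)^{\alpha-1}[S_\alpha(t-s)u(s)^p](x)\,ds$$ for almost all $t\in(0,T]$ and $x\in\mathbf R^N$ (a function $\phi$ being identified with the measure $\phi\,dx$). (1) For every $p>1$ there are constants $\gamma_1(\alpha)=\gamma_1(N,p,\alpha)>0$, $0<\alpha<1$, with $\limsup_{\alpha\to1-0}\gamma_1(\alpha)\in(0,\infty)$, such that for all $\alpha\in(0,1)$, $T\in(0,\infty)$ and all nonnegative Radon measures $\mu$ for which the problem has a nonnegative solution in $[0,T]\times\mathbf R^N$, $$\sup_{z\in\mathbf R^N}\mu(B(z,\sigma))\le\gamma_1(\alpha)\,\sigma^{N-\frac2{p-1}}\qquad\text{for all }\sigma\in(0,T^{\alpha/2}].$$ (2) Let $p=p_F:=1+2/N$. There are constants $\gamma_1'(\alpha)=\gamma_1'(N,\alpha)>0$, $0<\alpha<1$, with $\limsup_{\alpha\to1-0}\gamma_1'(\alpha)\in(0,\infty)$,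 such that for all $\alpha\in(0,1)$, $T\in(0,\infty)$ and all nonnegative Radon measures $\mu$ for which the problem has a nonnegative solution in $[0,T]\times\mathbf R^N$, $$\sup_{z\in\mathbf R^N}\mu(B(z,\sigma))\le\gamma_1'(\alpha)\left(\int_{\sigma^{2/\alpha}/(16T)}^{1/4}t^{-\alpha}\,dt\right)^{-\frac N2}\qquad\text{for all }\sigma\in(0,T^{\alpha/2}].$$ -/

import Mathlib

open MeasureTheory Set Filter Topology
open scoped ENNReal

namespace TimeFractional

noncomputable section

/-- The Gauss kernel `G(t,x) = (4πt)^{-N/2} exp(-|x|²/(4t))` on `ℝ^N`. -/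
def heatKernel (N : ℕ) (t : ℝ) (x : EuclideanSpace ℝ (Fin N)) : ℝ :=
  (4 * Real.pi * t) ^ (-((N : ℝ) / 2)) * Real.exp (-(‖x‖ ^ 2 / (4 * t)))

/-- `e^{tΔ} μ (x) = ∫ G(t, x - y) dμ(y)`, with values in `[0,∞]`. -/
def heatSemigroup {N : ℕ} (t : ℝ) (μ : Measure (EuclideanSpace ℝ (Fin N)))
    (x : EuclideanSpace ℝ (Fin N)) : ℝ≥0∞ :=
  ∫⁻ y, ENNReal.ofReal (heatKernel N t (x - y)) ∂μ

/-- The probability density `h_α` on `(0,∞)` (the Wright, or Mainardi, function)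
`h_α(θ) = ∑_{k ≥ 0} (-θ)^k / (k! Γ(1 - α - αk))`, whose Laplace transform is the
Mittag-Leffler function `E_{α,1}(-s)`. As usual `1/Γ` vanishes at the poles of `Γ`; this agrees
with `Real.Gamma` being `0` there and division by `0` being `0`. -/
def wrightDensity (α θ : ℝ) : ℝ :=
  ∑' k : ℕ, (-θ) ^ k / ((k.factorial : ℝ) * Real.Gamma (1 - α - α * k))

/-- `P_α(t) μ = ∫_0^∞ h_α(θ) e^{t^α θ Δ} μ dθ`. -/
def opP {N : ℕ} (α t : ℝ) (μ : Measure (EuclideanSpace ℝ (Fin N)))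
    (x : EuclideanSpace ℝ (Fin N)) : ℝ≥0∞ :=
  ∫⁻ θ in Ioi (0 : ℝ), ENNReal.ofReal (wrightDensity α θ) * heatSemigroup (t ^ α * θ) μ x

/-- `S_α(t) μ = ∫_0^∞ θ h_α(θ) e^{t^α θ Δ} μ dθ`. -/
def opS {N : ℕ} (α t : ℝ) (μ : Measure (EuclideanSpace ℝ (Fin N)))
    (x : EuclideanSpace ℝ (Fin N)) : ℝ≥0∞ :=
  ∫⁻ θ in Ioi (0 : ℝ), ENNReal.ofReal (θ * wrightDensity α θ) * heatSemigroup (t ^ α * θ) μ x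

/-- `u` is a nonnegative solution in `[0,T] × ℝ^N` of `∂_t^α u - Δu = u^p`, `u(0) = μ`:
`u` is a Lebesgue measurable `[0,∞]`-valued function on `(0,T] × ℝ^N` that is finite and satisfies
`u(t) = P_α(t)μ + α ∫_0^t (t-s)^{α-1} S_α(t-s) u(s)^p ds` almost everywhere.
The function `u(s)^p` is identified with the measure `u(s,y)^p dy`. -/
structure IsSolution {N : ℕ} (α p T : ℝ) (μ : Measure (EuclideanSpace ℝ (Fin N)))
    (u : ℝ → EuclideanSpace ℝ (Fin N) → ℝ≥0∞) : Prop where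
  aemeasurable : AEMeasurable (Function.uncurry u)
    ((volume.restrict (Ioc (0 : ℝ) T)).prod volume)
  finite : ∀ᵐ t ∂(volume.restrict (Ioc (0 : ℝ) T)), ∀ᵐ x, u t x < ∞
  eq : ∀ᵐ t ∂(volume.restrict (Ioc (0 : ℝ) T)), ∀ᵐ x,
    u t x = opP α t μ x + ENNReal.ofReal α *
      ∫⁻ s in Ioo (0 : ℝ) t, ENNReal.ofReal ((t - s) ^ (α - 1)) *
        opS α (t - s) (volume.withDensity fun y => u s y ^ p) x

/-- The Fujita exponent `p_F = 1 + 2/N`. -/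
def fujitaExponent (N : ℕ) : ℝ := 1 + 2 / (N : ℝ)

end

end TimeFractional

namespace TimeFractional

/-! Both bounds follow from self-amplification of lower bounds. Write M for the mass of a ball of
radius σ and τ = σ^{2/α}. The linear term gives u ≥ const·M σ^{-N} on the cylinder (τ/2, τ) ×
B(z,σ). Feeding a lower bound A into the Duhamel term on a cylinder of length δ with δ^α ≤ ρ²
returns a multiple of δ^α A^p. If δ^α A^{p-1} is too large, iteration makes u infinite on a set of
positive measure (`IsSolution.ball_bound`). This is the growth bound.

For p = 1 + 2/N the profile A t^{-αN/2} on |x - z| < t^{α/2} is scale invariant, and the Duhamel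
term reproduces it with the extra factor t^{α-1} ∫ s^{-α} ds. The coefficient can therefore be
doubled along times t_k. It is also bounded as long as t_k ≤ T/2, so the t_k must run out of room;
measuring that room gives `IsSolution.critical_bound`.

The density h_α enters only through `WrightMass`: some mass of its positive part lies on a compact
interval of (0,∞). For fixed α this holds because h_α(0) > 0. Uniformity as α → 1 comes from h_α →
δ_1, proved with an oscillatory integral for h_α on a rotated ray and Fourier inversion
(`tendsto_integral_mul_wrightDensity`). Nonnegativity of h_α is never needed. -/

/-! ### Lower bounds for the Gauss kernel and for P_α, S_α at parabolic scale. -/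

lemma heatKernel_lower {N : ℕ} {a b R τ θ : ℝ} (ha : 0 < a) (hR : 0 < R)
    (hτ : R ^ 2 / 2 ≤ τ) (hτ' : τ ≤ R ^ 2) (hθ : θ ∈ Icc a b)
    {x : EuclideanSpace ℝ (Fin N)} (hx : ‖x‖ ≤ 2 * R) :
    (4 * Real.pi * b) ^ (-((N : ℝ) / 2)) * Real.exp (-(2 / a)) / R ^ N
      ≤ heatKernel N (τ * θ) x := by
  have hθ0 : 0 < θ := ha.trans_le hθ.1
  have hb : 0 < b := hθ0.trans_le hθ.2
  have hτ0 : 0 < τ := lt_of_lt_of_le (by positivity) hτ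
  have hpi := Real.pi_pos
  have h1 : (4 * Real.pi * b) ^ (-((N : ℝ) / 2)) / R ^ N
      ≤ (4 * Real.pi * (τ * θ)) ^ (-((N : ℝ) / 2)) := by
    have h2 : (4 * Real.pi * b) ^ (-((N : ℝ) / 2)) / R ^ N
        = (4 * Real.pi * b * R ^ 2) ^ (-((N : ℝ) / 2)) := by
      rw [Real.mul_rpow (x := 4 * Real.pi * b) (by positivity) (by positivity), div_eq_mul_inv]
      congr 1
      rw [← Real.rpow_natCast R 2, ← Real.rpow_mul hR.le, ← Real.rpow_natCast R N,
        ← Real.rpow_neg hR.le]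
      congr 1
      push_cast
      ring
    rw [h2]
    refine Real.rpow_le_rpow_of_nonpos (by positivity) ?_ (by simp; positivity)
    have : τ * θ ≤ R ^ 2 * b := mul_le_mul hτ' hθ.2 hθ0.le (by positivity)
    nlinarith
  have h3 : Real.exp (-(2 / a)) ≤ Real.exp (-(‖x‖ ^ 2 / (4 * (τ * θ)))) := by
    apply Real.exp_le_exp.2
    apply neg_le_neg
    rw [div_le_div_iff₀ (by positivity) ha]
    have h4 : ‖x‖ ^ 2 ≤ (2 * R) ^ 2 := by gcongr
    have h5 : R ^ 2 / 2 * a ≤ τ * θ := mul_le_mul hτ hθ.1 ha.le hτ0.le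
    nlinarith [mul_le_mul_of_nonneg_right h4 ha.le]
  unfold heatKernel
  calc _ = (4 * Real.pi * b) ^ (-((N : ℝ) / 2)) / R ^ N * Real.exp (-(2 / a)) := by ring
    _ ≤ _ := mul_le_mul h1 h3 (by positivity) (by positivity)

/-- The constant in the lower bound of the Gauss kernel at parabolic distance. -/
noncomputable def gaussConst (N : ℕ) (a b : ℝ) : ℝ :=
  (4 * Real.pi * b) ^ (-((N : ℝ) / 2)) * Real.exp (-(2 / a))

lemma gaussConst_pos (N : ℕ) {a b : ℝ} (hb : 0 < b) : 0 < gaussConst N a b := by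
  have := Real.pi_pos
  unfold gaussConst
  positivity

lemma heatSemigroup_lower {N : ℕ} {a b R τ θ : ℝ} (ha : 0 < a) (hR : 0 < R)
    (hτ : R ^ 2 / 2 ≤ τ) (hτ' : τ ≤ R ^ 2) (hθ : θ ∈ Icc a b)
    (μ : Measure (EuclideanSpace ℝ (Fin N))) {x : EuclideanSpace ℝ (Fin N)}
    {B : Set (EuclideanSpace ℝ (Fin N))} (hB : MeasurableSet B)
    (hx : ∀ y ∈ B, ‖x - y‖ ≤ 2 * R) :
    ENNReal.ofReal (gaussConst N a b / R ^ N) * μ B ≤ heatSemigroup (τ * θ) μ x := by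
  unfold heatSemigroup
  calc _ = ∫⁻ y in B, ENNReal.ofReal (gaussConst N a b / R ^ N) ∂μ := by
        rw [setLIntegral_const]
    _ ≤ ∫⁻ y in B, ENNReal.ofReal (heatKernel N (τ * θ) (x - y)) ∂μ :=
        setLIntegral_mono' hB fun y hy =>
          ENNReal.ofReal_le_ofReal (heatKernel_lower ha hR hτ hτ' hθ (hx y hy))
    _ ≤ _ := setLIntegral_le_lintegral _ _

/-- The positive part of `h_α` has mass at least `c` on the compact interval `[a,b] ⊂ (0,∞)`. -/
structure WrightMass (α a b c : ℝ) : Prop where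
  a_pos : 0 < a
  b_pos : 0 < b
  c_pos : 0 < c
  le_mass : ENNReal.ofReal c ≤ ∫⁻ θ in Icc a b, ENNReal.ofReal (wrightDensity α θ)

/-- For θ in [a,b] the heat time t^α θ is comparable to R², so the kernel is at least a multiple of
R^{-N} at distance 2R; integrating over θ costs only the factor c. -/
lemma opP_lower {N : ℕ} {α a b c R t : ℝ} (h : WrightMass α a b c) (hR : 0 < R)
    (ht : R ^ 2 / 2 ≤ t ^ α) (ht' : t ^ α ≤ R ^ 2)
    (μ : Measure (EuclideanSpace ℝ (Fin N))) {x : EuclideanSpace ℝ (Fin N)}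
    {B : Set (EuclideanSpace ℝ (Fin N))} (hB : MeasurableSet B)
    (hx : ∀ y ∈ B, ‖x - y‖ ≤ 2 * R) :
    ENNReal.ofReal (c * gaussConst N a b / R ^ N) * μ B ≤ opP α t μ x := by
  unfold opP
  have hsub : Icc a b ⊆ Ioi (0 : ℝ) := fun θ hθ => h.a_pos.trans_le hθ.1
  calc _ = ENNReal.ofReal c * (ENNReal.ofReal (gaussConst N a b / R ^ N) * μ B) := by
        rw [mul_div_assoc, ENNReal.ofReal_mul h.c_pos.le, mul_assoc]
    _ ≤ (∫⁻ θ in Icc a b, ENNReal.ofReal (wrightDensity α θ)) *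
          (ENNReal.ofReal (gaussConst N a b / R ^ N) * μ B) := by gcongr; exact h.le_mass
    _ ≤ ∫⁻ θ in Icc a b, ENNReal.ofReal (wrightDensity α θ) *
          (ENNReal.ofReal (gaussConst N a b / R ^ N) * μ B) := lintegral_mul_const_le _ _
    _ ≤ ∫⁻ θ in Icc a b, ENNReal.ofReal (wrightDensity α θ) * heatSemigroup (t ^ α * θ) μ x := by
        refine setLIntegral_mono' measurableSet_Icc fun θ hθ => ?_
        gcongr
        exact heatSemigroup_lower h.a_pos hR ht ht' hθ μ hB hx
    _ ≤ _ := lintegral_mono_set hsub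

lemma opS_lower {N : ℕ} {α a b c R t : ℝ} (h : WrightMass α a b c) (hR : 0 < R)
    (ht : R ^ 2 / 2 ≤ t ^ α) (ht' : t ^ α ≤ R ^ 2)
    (μ : Measure (EuclideanSpace ℝ (Fin N))) {x : EuclideanSpace ℝ (Fin N)}
    {B : Set (EuclideanSpace ℝ (Fin N))} (hB : MeasurableSet B)
    (hx : ∀ y ∈ B, ‖x - y‖ ≤ 2 * R) :
    ENNReal.ofReal (a * c * gaussConst N a b / R ^ N) * μ B ≤ opS α t μ x := by
  have hsub : Icc a b ⊆ Ioi (0 : ℝ) := fun θ hθ => h.a_pos.trans_le hθ.1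
  unfold opS
  calc _ = ENNReal.ofReal c * (ENNReal.ofReal a *
          (ENNReal.ofReal (gaussConst N a b / R ^ N) * μ B)) := by
        rw [mul_div_assoc, mul_comm a c, ENNReal.ofReal_mul (mul_nonneg h.c_pos.le h.a_pos.le),
          ENNReal.ofReal_mul h.c_pos.le]
        ring
    _ ≤ (∫⁻ θ in Icc a b, ENNReal.ofReal (wrightDensity α θ)) * (ENNReal.ofReal a *
          (ENNReal.ofReal (gaussConst N a b / R ^ N) * μ B)) := by gcongr; exact h.le_mass
    _ ≤ ∫⁻ θ in Icc a b, ENNReal.ofReal (wrightDensity α θ) * (ENNReal.ofReal a *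
          (ENNReal.ofReal (gaussConst N a b / R ^ N) * μ B)) := lintegral_mul_const_le _ _
    _ ≤ ∫⁻ θ in Icc a b,
          ENNReal.ofReal (θ * wrightDensity α θ) * heatSemigroup (t ^ α * θ) μ x := by
        refine setLIntegral_mono' measurableSet_Icc fun θ hθ => ?_
        rw [ENNReal.ofReal_mul (h.a_pos.le.trans hθ.1), ← mul_assoc,
          mul_comm (ENNReal.ofReal (wrightDensity α θ))]
        gcongr
        · exact hθ.1
        · exact heatSemigroup_lower h.a_pos hR ht ht' hθ μ hB hx
    _ ≤ _ := lintegral_mono_set hsub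

lemma volume_ball_eq {N : ℕ} (w : EuclideanSpace ℝ (Fin N)) {r : ℝ} (hr : 0 < r) :
    volume (Metric.ball w r) =
      ENNReal.ofReal ((volume (Metric.ball (0 : EuclideanSpace ℝ (Fin N)) 1)).toReal * r ^ N) := by
  rw [Measure.addHaar_ball_of_pos _ _ hr, finrank_euclideanSpace_fin, mul_comm,
    ENNReal.ofReal_mul ENNReal.toReal_nonneg, ENNReal.ofReal_toReal measure_ball_lt_top.ne]

/-- Volume of the unit ball of `ℝ^N`. -/
noncomputable def unitBallVolume (N : ℕ) : ℝ :=
  (volume (Metric.ball (0 : EuclideanSpace ℝ (Fin N)) 1)).toReal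

lemma unitBallVolume_pos (N : ℕ) : 0 < unitBallVolume N :=
  ENNReal.toReal_pos (Metric.measure_ball_pos _ _ one_pos).ne' measure_ball_lt_top.ne

lemma withDensity_ball_lower {N : ℕ} {p A r ρ : ℝ} (hp : 0 ≤ p) (hA : 0 ≤ A)
    (hr : 0 < r) {w z : EuclideanSpace ℝ (Fin N)} (hsub : Metric.ball w r ⊆ Metric.ball z ρ)
    {f : EuclideanSpace ℝ (Fin N) → ℝ≥0∞}
    (hf : ∀ᵐ y ∂(volume.restrict (Metric.ball z ρ)), ENNReal.ofReal A ≤ f y) :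
    ENNReal.ofReal (A ^ p * (unitBallVolume N * r ^ N)) ≤
      (volume.withDensity fun y => f y ^ p) (Metric.ball w r) := by
  rw [withDensity_apply _ measurableSet_ball, ENNReal.ofReal_mul (by positivity), unitBallVolume,
    ← volume_ball_eq w hr, ← ENNReal.ofReal_rpow_of_nonneg hA hp, ← setLIntegral_const]
  refine lintegral_mono_ae ?_
  filter_upwards [ae_restrict_of_ae_restrict_of_subset hsub hf] with y hy
  gcongr

/-- The coefficient by which the nonlinear term amplifies a lower bound on a ball. -/
noncomputable def ampConst (N : ℕ) (α₀ a b c : ℝ) : ℝ :=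
  α₀ * (a * c * gaussConst N a b * unitBallVolume N) / 2 ^ N

lemma ampConst_pos (N : ℕ) {α₀ α a b c : ℝ} (h : WrightMass α a b c) (hα₀ : 0 < α₀) :
    0 < ampConst N α₀ a b c := by
  have := h.a_pos
  have := h.c_pos
  have := gaussConst_pos N (a := a) h.b_pos
  have := unitBallVolume_pos N
  unfold ampConst
  positivity

/-- No power of τ is lost: the mass of a ball of radius comparable to τ^{α/2} cancels the kernel
factor τ^{-αN/2}. -/
lemma opS_ball_lower {N : ℕ} {α a b c p A ρ τ : ℝ} (h : WrightMass α a b c)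
    (hp : 0 ≤ p) (hA : 0 ≤ A) (hτ : 0 < τ) (hτρ : τ ^ α ≤ ρ ^ 2) (hρ : 0 < ρ)
    {z x : EuclideanSpace ℝ (Fin N)} (hx : x ∈ Metric.ball z ρ)
    {f : EuclideanSpace ℝ (Fin N) → ℝ≥0∞}
    (hf : ∀ᵐ y ∂(volume.restrict (Metric.ball z ρ)), ENNReal.ofReal A ≤ f y) :
    ENNReal.ofReal (ampConst N 1 a b c * A ^ p) ≤
      opS α τ (volume.withDensity fun y => f y ^ p) x := by
  set R : ℝ := τ ^ (α / 2) with hRdef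
  have hR : 0 < R := by positivity
  have hR2 : R ^ 2 = τ ^ α := by
    rw [hRdef, ← Real.rpow_natCast, ← Real.rpow_mul hτ.le]; congr 1; push_cast; ring
  have hRρ : R ≤ ρ := by
    rw [← hR2] at hτρ
    exact le_of_sq_le_sq hτρ hρ.le
  -- Moving x towards z by at most R/2 gives a ball of radius R/2 that is still inside B(z,ρ), even
  -- for x near the boundary. The halved radius is the source of 2^N in `ampConst`.
  set w := x - (R / (2 * ρ)) • (x - z) with hw
  have hxz : ‖x - z‖ < ρ := by simpa [dist_eq_norm] using hx
  have hcoef : 0 ≤ R / (2 * ρ) ∧ R / (2 * ρ) ≤ 1 := by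
    refine ⟨by positivity, ?_⟩
    rw [div_le_one (by positivity)]; linarith
  have hwx : ‖x - w‖ ≤ R / 2 := by
    have : x - w = (R / (2 * ρ)) • (x - z) := by rw [hw]; abel
    rw [this, norm_smul, Real.norm_of_nonneg hcoef.1]
    calc _ ≤ R / (2 * ρ) * ρ := by gcongr
      _ = R / 2 := by field_simp
  have hwz : ‖w - z‖ ≤ ρ - R / 2 := by
    have : w - z = (1 - R / (2 * ρ)) • (x - z) := by rw [hw, sub_smul, one_smul]; abel
    rw [this, norm_smul, Real.norm_of_nonneg (by linarith [hcoef.2])]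
    calc _ ≤ (1 - R / (2 * ρ)) * ρ := by
          gcongr
          linarith [hcoef.2]
      _ = ρ - R / 2 := by field_simp
  have hsub : Metric.ball w (R / 2) ⊆ Metric.ball z ρ := by
    refine Metric.ball_subset_ball' ?_
    rw [dist_eq_norm]; linarith
  have h1 := withDensity_ball_lower hp hA (half_pos hR) hsub hf
  have h2 := opS_lower h hR (by rw [hR2]; linarith [Real.rpow_pos_of_pos hτ α]) hR2.ge
    (volume.withDensity fun y => f y ^ p) (x := x) (B := Metric.ball w (R / 2))
    measurableSet_ball (by
      intro y hy
      have h3 : ‖w - y‖ < R / 2 := by simpa [dist_eq_norm, norm_sub_rev] using hy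
      have := norm_add_le (x - w) (w - y)
      simp only [sub_add_sub_cancel] at this
      linarith)
  refine le_trans ?_ h2
  refine le_trans ?_ (mul_le_mul_right h1 _)
  have := h.a_pos
  have := h.c_pos
  have := gaussConst_pos N (a := a) h.b_pos
  rw [← ENNReal.ofReal_mul (by positivity)]
  apply ENNReal.ofReal_le_ofReal
  apply le_of_eq
  unfold ampConst
  rw [div_pow]
  field_simp

/-! ### The Gamma integral with a complex rate in the right half-plane. -/

lemma integrableOn_rpow_mul_cexp {s : ℝ} (hs : -1 < s) {c : ℂ} (hc : 0 < c.re) :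
    IntegrableOn (fun r : ℝ => ((r ^ s : ℝ) : ℂ) * Complex.exp (-(c * r))) (Ioi 0) := by
  have h := integrableOn_rpow_mul_exp_neg_mul_rpow (p := 1) hs one_pos hc
  refine h.mono' ?_ ?_
  · refine ContinuousOn.aestronglyMeasurable ?_ measurableSet_Ioi
    refine ContinuousOn.mul ?_ (by fun_prop)
    exact Complex.continuous_ofReal.comp_continuousOn
      (ContinuousOn.rpow_const continuousOn_id fun x hx => Or.inl (ne_of_gt hx))
  · refine (ae_restrict_iff' measurableSet_Ioi).2 (Eventually.of_forall fun r hr => ?_)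
    rw [norm_mul, Complex.norm_real, Complex.norm_exp, Real.norm_of_nonneg
      (Real.rpow_nonneg (le_of_lt hr) _)]
    simp

lemma hasDerivAt_integral_rpow_mul_cexp {s : ℝ} (hs : 0 < s) {c : ℂ} (hc : 0 < c.re) :
    HasDerivAt (fun c : ℂ => ∫ r in Ioi (0 : ℝ),
        ((r ^ (s - 1) : ℝ) : ℂ) * Complex.exp (-(c * r)))
      (-∫ r in Ioi (0 : ℝ), ((r ^ s : ℝ) : ℂ) * Complex.exp (-(c * r))) c := by
  rw [← integral_neg]
  have hc2 : 0 < c.re / 2 := half_pos hc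
  have hb := integrableOn_rpow_mul_exp_neg_mul_rpow (p := 1) (s := s) (by linarith) one_pos hc2
  have hre : ∀ c' ∈ Metric.ball c (c.re / 2), c.re / 2 < c'.re := by
    intro c' hc'
    have h1 : |(c' - c).re| ≤ ‖c' - c‖ := Complex.abs_re_le_norm _
    have h2 : ‖c' - c‖ < c.re / 2 := by simpa [dist_eq_norm] using hc'
    rw [Complex.sub_re] at h1
    linarith [(abs_le.1 (h1.trans h2.le)).1, neg_abs_le (c'.re - c.re)]
  refine (hasDerivAt_integral_of_dominated_loc_of_deriv_le
    (F := fun (c : ℂ) (r : ℝ) => ((r ^ (s - 1) : ℝ) : ℂ) * Complex.exp (-(c * r)))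
    (F' := fun (c : ℂ) (r : ℝ) => -(((r ^ s : ℝ) : ℂ) * Complex.exp (-(c * r))))
    (bound := fun r => r ^ s * Real.exp (-(c.re / 2) * r ^ (1 : ℝ)))
    (Metric.ball_mem_nhds c hc2) ?_ ?_ ?_ ?_ hb ?_).2
  · filter_upwards [Metric.ball_mem_nhds c hc2] with c' hc'
    exact (integrableOn_rpow_mul_cexp (by linarith) (hc2.trans (hre c' hc'))).aestronglyMeasurable
  · exact integrableOn_rpow_mul_cexp (by linarith) hc
  · exact (integrableOn_rpow_mul_cexp (by linarith) hc).aestronglyMeasurable.neg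
  · refine (ae_restrict_iff' measurableSet_Ioi).2 (Eventually.of_forall fun r hr c' hc' => ?_)
    have hr0 : 0 < r := hr
    rw [norm_neg, norm_mul, Complex.norm_real, Complex.norm_exp, Real.norm_of_nonneg
      (Real.rpow_nonneg hr0.le _)]
    gcongr
    simp only [Complex.neg_re, Complex.mul_re, Complex.ofReal_re, Complex.ofReal_im, mul_zero,
      sub_zero, Real.rpow_one]
    nlinarith [hre c' hc']
  · refine (ae_restrict_iff' measurableSet_Ioi).2 (Eventually.of_forall fun r hr c' _ => ?_)
    have hr0 : 0 < r := hr
    have h1 : HasDerivAt (fun c : ℂ => -(c * r)) (-(1 * (r : ℂ))) c' :=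
      ((hasDerivAt_id c').mul_const _).neg
    refine (h1.cexp.const_mul ((r ^ (s - 1) : ℝ) : ℂ)).congr_deriv ?_
    have : r ^ s = r ^ (s - 1) * r := by
      rw [← Real.rpow_add_one hr0.ne']; congr 1; ring
    rw [this]
    push_cast
    ring

lemma integral_rpow_mul_cexp_parts {s : ℝ} (hs : 0 < s) {c : ℂ} (hc : 0 < c.re) :
    c * ∫ r in Ioi (0 : ℝ), ((r ^ s : ℝ) : ℂ) * Complex.exp (-(c * r)) =
      s * ∫ r in Ioi (0 : ℝ), ((r ^ (s - 1) : ℝ) : ℂ) * Complex.exp (-(c * r)) := by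
  have hi1 := (integrableOn_rpow_mul_cexp (s := s) (by linarith) hc).const_mul c
  have hi2 := (integrableOn_rpow_mul_cexp (s := s - 1) (by linarith) hc).const_mul (s : ℂ)
  have key : ∫ r in Ioi (0 : ℝ), ((s : ℂ) * (((r ^ (s - 1) : ℝ) : ℂ) * Complex.exp (-(c * r))) -
      c * (((r ^ s : ℝ) : ℂ) * Complex.exp (-(c * r)))) = 0 := by
    have h0 : (((0 : ℝ) ^ s : ℝ) : ℂ) * Complex.exp (-(c * (0 : ℝ))) = 0 := by
      rw [Real.zero_rpow hs.ne', Complex.ofReal_zero, zero_mul]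
    rw [show (0 : ℂ) = 0 - ((0 : ℝ) ^ s : ℝ) * Complex.exp (-(c * (0 : ℝ))) by rw [h0, sub_zero]]
    refine integral_Ioi_of_hasDerivAt_of_tendsto (a := (0 : ℝ))
      (f := fun r : ℝ => ((r ^ s : ℝ) : ℂ) * Complex.exp (-(c * r))) ?_ ?_ (hi2.sub hi1) ?_
    · refine ContinuousAt.continuousWithinAt (ContinuousAt.mul ?_ (by fun_prop))
      exact Complex.continuous_ofReal.continuousAt.comp
        (Real.continuousAt_rpow_const _ _ (Or.inr hs.le))
    · intro r hr
      have hr0 : (0 : ℝ) < r := hr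
      have h1 : HasDerivAt (fun r : ℝ => -(c * (r : ℂ))) (-(c * 1)) r :=
        ((Complex.ofRealCLM.hasDerivAt (x := r)).const_mul c).neg
      have h2 : HasDerivAt (fun r : ℝ => ((r ^ s : ℝ) : ℂ)) ((s * r ^ (s - 1) : ℝ) : ℂ) r :=
        (Real.hasDerivAt_rpow_const (Or.inl hr0.ne')).ofReal_comp
      refine (h2.mul h1.cexp).congr_deriv ?_
      push_cast
      ring
    · rw [tendsto_zero_iff_norm_tendsto_zero]
      refine (tendsto_rpow_mul_exp_neg_mul_atTop_nhds_zero s c.re hc).congr' ?_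
      filter_upwards [eventually_gt_atTop 0] with r hr
      rw [norm_mul, Complex.norm_real, Complex.norm_exp, Real.norm_of_nonneg
        (Real.rpow_nonneg hr.le _)]
      simp
  rw [integral_sub hi2 hi1, integral_const_mul, integral_const_mul] at key
  linear_combination -key

/-- Differentiation under the integral and integration by parts show that c^s F(c) has zero
derivative on the connected half-plane Re c > 0; its value at c = 1 is Γ(s). -/
lemma integral_rpow_mul_cexp {s : ℝ} (hs : 0 < s) {c : ℂ} (hc : 0 < c.re) :
    ∫ r in Ioi (0 : ℝ), ((r ^ (s - 1) : ℝ) : ℂ) * Complex.exp (-(c * r)) =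
      c ^ (-(s : ℂ)) * Real.Gamma s := by
  set F : ℂ → ℂ := fun c => ∫ r in Ioi (0 : ℝ), ((r ^ (s - 1) : ℝ) : ℂ) * Complex.exp (-(c * r))
    with hF
  set U : Set ℂ := {z | 0 < z.re} with hU
  have hUo : IsOpen U := isOpen_lt continuous_const Complex.continuous_re
  have hUc : IsPreconnected U := (convex_halfSpace_re_gt 0).isPreconnected
  have hslit : ∀ z ∈ U, z ∈ Complex.slitPlane := fun z hz => Or.inl hz
  have hderiv : ∀ z ∈ U, HasDerivAt (fun z => z ^ (s : ℂ) * F z) 0 z := by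
    intro z hz
    have hz0 : z ≠ 0 := Complex.slitPlane_ne_zero (hslit z hz)
    have h1 := (((hasDerivAt_id z).cpow_const (c := (s : ℂ)) (hslit z hz)).mul
      (hasDerivAt_integral_rpow_mul_cexp hs hz))
    refine h1.congr_deriv ?_
    have h2 := integral_rpow_mul_cexp_parts hs hz
    have h3 : z ^ (s : ℂ) = z ^ ((s : ℂ) - 1) * z := by
      rw [Complex.cpow_sub _ _ hz0, Complex.cpow_one, div_mul_cancel₀ _ hz0]
    simp only [id, h3]
    linear_combination -(z ^ ((s : ℂ) - 1)) * h2
  have h1U : (1 : ℂ) ∈ U := by simp [hU]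
  have hconst := hUo.is_const_of_deriv_eq_zero hUc
    (fun z hz => (hderiv z hz).differentiableAt.differentiableWithinAt)
    (fun z hz => (hderiv z hz).deriv) hc h1U
  have hF1 : F 1 = Real.Gamma s := by
    rw [Real.Gamma_eq_integral hs, hF, ← integral_complex_ofReal]
    simp only
    congr 1
    ext r
    push_cast
    rw [one_mul]; ring
  have hc0 : c ≠ 0 := Complex.slitPlane_ne_zero (hslit c hc)
  simp only [Complex.one_cpow, one_mul, hF1] at hconst
  rw [← hconst, ← mul_assoc, ← Complex.cpow_add _ _ hc0, neg_add_cancel, Complex.cpow_zero, one_mul]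

/-! ### An oscillatory integral for h_α on a rotated ray. -/

/-- The point of the unit circle with argument `π/(2α) - π`. -/
noncomputable def rotation (α : ℝ) : ℂ :=
  Complex.exp (((Real.pi / (2 * α) - Real.pi : ℝ) : ℂ) * Complex.I)

lemma rotation_arg_mem {α : ℝ} (hα : α ∈ Ioo (1 / 2 : ℝ) 1) :
    Real.pi / (2 * α) - Real.pi ∈ Ioo (-(Real.pi / 2)) 0 := by
  have hpi := Real.pi_pos
  obtain ⟨h1, h2⟩ := hα
  constructor
  · have : Real.pi / 2 < Real.pi / (2 * α) := by
      apply div_lt_div_of_pos_left hpi <;> linarith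
    linarith
  · have : Real.pi / (2 * α) < Real.pi := by
      rw [div_lt_iff₀ (by linarith)]; nlinarith
    linarith

/-- The condition α > 1/2 keeps the argument above -π/2, so exp(-c ρ^{1/α}) decays. -/
lemma rotation_re_pos {α : ℝ} (hα : α ∈ Ioo (1 / 2 : ℝ) 1) : 0 < (rotation α).re := by
  have h := rotation_arg_mem hα
  rw [rotation, Complex.exp_ofReal_mul_I_re]
  exact Real.cos_pos_of_mem_Ioo ⟨h.1, by linarith [h.2, Real.pi_pos]⟩

lemma rotation_cpow {α : ℝ} (hα : α ∈ Ioo (1 / 2 : ℝ) 1) (s : ℝ) :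
    rotation α ^ (-(s : ℂ)) =
      Complex.exp (((-(s * (Real.pi / (2 * α) - Real.pi)) : ℝ) : ℂ) * Complex.I) := by
  have h := rotation_arg_mem hα
  have hpi := Real.pi_pos
  rw [rotation, Complex.cpow_def_of_ne_zero (Complex.exp_ne_zero _), Complex.log_exp]
  · congr 1; push_cast; ring
  · rw [Complex.im_ofReal_mul, Complex.I_im]; linarith [h.1]
  · rw [Complex.im_ofReal_mul, Complex.I_im]; linarith [h.2]

lemma norm_cexp_rotation {α ρ : ℝ} :
    ‖Complex.exp (-(rotation α * ((ρ ^ (1 / α) : ℝ) : ℂ)))‖ =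
      Real.exp (-(rotation α).re * ρ ^ (1 / α)) := by
  rw [Complex.norm_exp]; simp

lemma continuous_cexp_rotation {α : ℝ} (hα : 0 < α) :
    Continuous fun ρ : ℝ => Complex.exp (-(rotation α * ((ρ ^ (1 / α) : ℝ) : ℂ))) := by
  have : Continuous fun ρ : ℝ => ρ ^ (1 / α) := Real.continuous_rpow_const (by positivity)
  fun_prop

lemma integrableOn_cexp_rotation {α : ℝ} (hα : α ∈ Ioo (1 / 2 : ℝ) 1) :
    IntegrableOn (fun ρ : ℝ => Complex.exp (-(rotation α * ((ρ ^ (1 / α) : ℝ) : ℂ)))) (Ioi 0) := by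
  have hα0 : 0 < α := by linarith [hα.1]
  have h := integrableOn_rpow_mul_exp_neg_mul_rpow (p := 1 / α) (s := 0) (by norm_num)
    (by positivity) (rotation_re_pos hα)
  refine h.mono' (continuous_cexp_rotation hα0).aestronglyMeasurable (Eventually.of_forall ?_)
  intro ρ
  simp only [norm_cexp_rotation, Real.rpow_zero, one_mul, le_refl]

/-- The substitution ρ = r^α reduces the moments to Gamma integrals. -/
lemma integral_pow_mul_cexp_rotation {α : ℝ} (hα : α ∈ Ioo (1 / 2 : ℝ) 1) (k : ℕ) :
    ∫ ρ in Ioi (0 : ℝ), (ρ : ℂ) ^ k * Complex.exp (-(rotation α * ((ρ ^ (1 / α) : ℝ) : ℂ))) =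
      α * (rotation α ^ (-((α * (k + 1) : ℝ) : ℂ)) * Real.Gamma (α * (k + 1))) := by
  have hα0 : 0 < α := by linarith [hα.1]
  rw [← integral_rpow_mul_cexp (by positivity) (rotation_re_pos hα), ← integral_comp_rpow_Ioi_of_pos hα0,
    ← integral_const_mul]
  refine setIntegral_congr_fun measurableSet_Ioi fun r hr => ?_
  have hr0 : (0 : ℝ) < r := hr
  have h1 : (r ^ α) ^ (1 / α) = r := by
    rw [← Real.rpow_mul hr0.le, mul_one_div_cancel hα0.ne', Real.rpow_one]
  have h2 : r ^ (α * (k + 1) - 1) = r ^ (α - 1) * (r ^ α) ^ k := by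
    rw [← Real.rpow_natCast (r ^ α), ← Real.rpow_mul hr0.le, ← Real.rpow_add hr0]
    congr 1; ring
  simp only [h1, h2, Complex.real_smul]
  push_cast
  ring

/-- With p = 1/α > 1 this is the dominating function that allows the exponential series to be
integrated term by term. -/
lemma integrableOn_exp_mul_exp_neg_rpow {p b : ℝ} (hp : 1 < p) (hb : 0 < b) (M : ℝ) :
    IntegrableOn (fun ρ : ℝ => Real.exp (M * ρ) * Real.exp (-b * ρ ^ p)) (Ioi 0) := by
  refine integrable_of_isBigO_exp_neg (b := 1) one_pos ?_ ?_
  · have : Continuous fun ρ : ℝ => ρ ^ p := Real.continuous_rpow_const (by positivity)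
    fun_prop
  · simp_rw [← Real.exp_add]
    refine (Asymptotics.IsBigO.of_bound 1 ?_)
    have h : Tendsto (fun ρ : ℝ => ρ ^ (p - 1)) atTop atTop := tendsto_rpow_atTop (by linarith)
    filter_upwards [h.eventually_ge_atTop ((M + 1) / b), eventually_gt_atTop 0] with ρ h1 h2
    rw [one_mul, Real.norm_of_nonneg (Real.exp_nonneg _), Real.norm_of_nonneg (Real.exp_nonneg _)]
    apply Real.exp_le_exp.2
    have h3 : ρ ^ p = ρ ^ (p - 1) * ρ := by rw [← Real.rpow_add_one h2.ne']; congr 1; ring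
    rw [div_le_iff₀ hb] at h1
    rw [h3]
    nlinarith

/-- Euler's reflection formula. It remains valid at the poles of Γ, where the sine vanishes and both
sides are 0 under the division convention. -/
lemma wrightDensity_term {α : ℝ} (hα : 0 < α) (θ : ℝ) (k : ℕ) :
    (-θ) ^ k / ((k.factorial : ℝ) * Real.Gamma (1 - α - α * k)) =
      (-θ) ^ k / (k.factorial : ℝ) *
        (Real.Gamma (α * (k + 1)) * Real.sin (Real.pi * (α * (k + 1))) / Real.pi) := by
  have h := Real.Gamma_mul_Gamma_one_sub (α * (k + 1))
  have hG : 0 < Real.Gamma (α * (k + 1)) := Real.Gamma_pos_of_pos (by positivity)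
  have e : 1 - α - α * k = 1 - α * (k + 1) := by ring
  have hG' : Real.Gamma (1 - α * (k + 1)) =
      Real.pi / Real.sin (Real.pi * (α * (k + 1))) / Real.Gamma (α * (k + 1)) := by
    rw [← h]; field_simp
  rw [e, hG', div_mul_eq_div_div]
  simp only [div_eq_mul_inv, mul_inv, inv_inv]
  ring

/-- `h_α` as a Fourier integral, for `1/2 < α < 1`. -/
lemma wrightDensity_eq_integral {α : ℝ} (hα : α ∈ Ioo (1 / 2 : ℝ) 1) (θ : ℝ) :
    wrightDensity α θ = (Real.pi * α)⁻¹ * (∫ ρ in Ioi (0 : ℝ), Complex.exp (-(θ * ρ * Complex.I)) *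
      Complex.exp (-(rotation α * ((ρ ^ (1 / α) : ℝ) : ℂ)))).re := by
  have hα0 : 0 < α := by linarith [hα.1]
  have hpi := Real.pi_pos
  have hb := rotation_re_pos hα
  have hsum : HasSum (fun k : ℕ => ∫ ρ in Ioi (0 : ℝ),
      ((-(θ * ρ * Complex.I)) ^ k / k.factorial) *
        Complex.exp (-(rotation α * ((ρ ^ (1 / α) : ℝ) : ℂ))))
      (∫ ρ in Ioi (0 : ℝ), Complex.exp (-(θ * ρ * Complex.I)) *
        Complex.exp (-(rotation α * ((ρ ^ (1 / α) : ℝ) : ℂ)))) := by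
    have hexp : ∀ ρ : ℝ, HasSum (fun k : ℕ => (|θ * ρ|) ^ k / k.factorial) (Real.exp |θ * ρ|) := by
      intro ρ
      rw [Real.exp_eq_exp_ℝ]
      exact NormedSpace.expSeries_div_hasSum_exp _
    refine hasSum_integral_of_dominated_convergence
      (fun (k : ℕ) (ρ : ℝ) => (|θ * ρ|) ^ k / k.factorial *
        Real.exp (-(rotation α).re * ρ ^ (1 / α))) ?_ ?_ ?_ ?_ ?_
    · intro k
      refine Continuous.aestronglyMeasurable ?_
      exact Continuous.mul (by fun_prop) (continuous_cexp_rotation hα0)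
    · intro k
      refine Eventually.of_forall fun ρ => ?_
      rw [norm_mul, norm_cexp_rotation]
      simp
    · exact Eventually.of_forall fun ρ => ((hexp ρ).mul_right _).summable
    · have h1 := integrableOn_exp_mul_exp_neg_rpow (p := 1 / α)
        (by rw [lt_div_iff₀ hα0]; linarith [hα.2]) hb |θ|
      refine h1.congr_fun (fun ρ hρ => ?_) measurableSet_Ioi
      have hρ0 : (0 : ℝ) < ρ := hρ
      simp only
      rw [((hexp ρ).mul_right _).tsum_eq, abs_mul, abs_of_pos hρ0]
    · refine Eventually.of_forall fun ρ => ?_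
      refine HasSum.mul_right _ ?_
      rw [Complex.exp_eq_exp_ℂ]
      exact NormedSpace.expSeries_div_hasSum_exp _
  have hre := (Complex.hasSum_re hsum).mul_left (Real.pi * α)⁻¹
  rw [← hre.tsum_eq, wrightDensity]
  congr 1
  ext k
  rw [wrightDensity_term hα0]
  have hterm : ∫ ρ in Ioi (0 : ℝ), ((-(θ * ρ * Complex.I)) ^ k / k.factorial) *
        Complex.exp (-(rotation α * ((ρ ^ (1 / α) : ℝ) : ℂ))) =
      ((-θ) ^ k / k.factorial * (α * Real.Gamma (α * (k + 1))) : ℝ) *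
        (Complex.I ^ k * rotation α ^ (-((α * (k + 1) : ℝ) : ℂ))) := by
    have h2 := integral_pow_mul_cexp_rotation hα k
    calc _ = ∫ ρ in Ioi (0 : ℝ), ((-θ * Complex.I) ^ k / k.factorial) * ((ρ : ℂ) ^ k *
        Complex.exp (-(rotation α * ((ρ ^ (1 / α) : ℝ) : ℂ)))) := by
          congr 1; ext ρ
          rw [show -(θ * ρ * Complex.I) = (-θ * Complex.I) * ρ by ring, mul_pow]
          ring
      _ = _ := by
          rw [integral_const_mul, h2, mul_pow]
          push_cast
          ring
  rw [hterm, Complex.re_ofReal_mul]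
  -- The angle of the ray is chosen for this identity: kπ/2 - α(k+1)(π/(2α) - π) = -π/2 + πα(k+1),
  -- so the real part is the sine in the reflection formula.
  have hphase : Complex.I ^ k * rotation α ^ (-((α * (k + 1) : ℝ) : ℂ)) =
      -Complex.I * Complex.exp (((Real.pi * (α * (k + 1)) : ℝ) : ℂ) * Complex.I) := by
    rw [rotation_cpow hα]
    have hI : Complex.I = Complex.exp (((Real.pi / 2 : ℝ) : ℂ) * Complex.I) := by
      push_cast; exact Complex.exp_pi_div_two_mul_I.symm
    have hnI : -Complex.I = Complex.exp (((-(Real.pi / 2) : ℝ) : ℂ) * Complex.I) := by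
      push_cast; rw [← Complex.exp_neg_pi_div_two_mul_I, neg_div]
    conv_lhs => rw [hI]
    rw [← Complex.exp_nat_mul, ← Complex.exp_add, ← hI, hnI, ← Complex.exp_add]
    congr 1
    have hα' : (α : ℂ) ≠ 0 := by exact_mod_cast hα0.ne'
    push_cast
    field_simp
    ring
  rw [hphase]
  have : (-Complex.I * Complex.exp (((Real.pi * (α * (k + 1)) : ℝ) : ℂ) * Complex.I)).re =
      Real.sin (Real.pi * (α * (k + 1))) := by
    rw [neg_mul, Complex.neg_re, Complex.I_mul_re, Complex.exp_ofReal_mul_I_im, neg_neg]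
  rw [this]
  field_simp

/-! ### Concentration of h_α at θ = 1 as α → 1. -/

open scoped FourierTransform

/-- The kernel `φ(θ) e^{-iθρ} exp(-c ρ^{1/α})` is integrable in `(θ,ρ)`. -/
lemma integrable_prod_cexp {α : ℝ} (hα : α ∈ Ioo (1 / 2 : ℝ) 1) {φ : ℝ → ℂ}
    (hφ : Integrable φ) :
    Integrable (fun q : ℝ × ℝ => Complex.exp (-(q.1 * q.2 * Complex.I)) *
      (φ q.1 * Complex.exp (-(rotation α * ((q.2 ^ (1 / α) : ℝ) : ℂ)))))
      (volume.prod (volume.restrict (Ioi 0))) := by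
  refine (hφ.mul_prod (integrableOn_cexp_rotation hα)).bdd_mul (c := 1)
    (Continuous.aestronglyMeasurable (by fun_prop)) (Eventually.of_forall fun q => ?_)
  rw [Complex.norm_exp]
  simp

/-- Fubini moves the oscillating factor onto φ, leaving its Fourier transform against the decaying
factor. -/
lemma integrable_mul_wrightDensity {α : ℝ} (hα : α ∈ Ioo (1 / 2 : ℝ) 1) {φ : ℝ → ℝ}
    (hφ : Integrable φ) :
    Integrable (fun θ => φ θ * wrightDensity α θ) ∧
    ∫ θ, φ θ * wrightDensity α θ = (Real.pi * α)⁻¹ *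
      (∫ ρ in Ioi (0 : ℝ), 𝓕 (fun θ => (φ θ : ℂ)) (ρ / (2 * Real.pi)) *
        Complex.exp (-(rotation α * ((ρ ^ (1 / α) : ℝ) : ℂ)))).re := by
  have hpi := Real.pi_pos
  have hφ' : Integrable fun θ => (φ θ : ℂ) := hφ.ofReal
  have hint := integrable_prod_cexp hα hφ'
  have heq : (fun θ => φ θ * wrightDensity α θ) = fun θ : ℝ => (Real.pi * α)⁻¹ *
      (∫ ρ in Ioi (0 : ℝ), Complex.exp (-(θ * ρ * Complex.I)) *
      ((φ θ : ℂ) * Complex.exp (-(rotation α * ((ρ ^ (1 / α) : ℝ) : ℂ))))).re := by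
    ext θ
    rw [wrightDensity_eq_integral hα, mul_left_comm, ← Complex.re_ofReal_mul, ← integral_const_mul]
    congr 3
    ext ρ
    ring
  have hint1 := hint.integral_prod_left
  refine ⟨?_, ?_⟩
  · rw [heq]
    exact hint1.re.const_mul _
  · rw [heq, integral_const_mul]
    congr 1
    have h1 := integral_re (𝕜 := ℂ) hint1
    simp only [RCLike.re_to_complex] at h1
    refine h1.trans ?_
    rw [integral_integral_swap hint]
    congr 2
    ext ρ
    rw [Real.fourier_real_eq_integral_exp_smul, ← integral_mul_const]
    congr 1
    ext θ
    rw [smul_eq_mul, ← mul_assoc]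
    congr 3
    have : (Real.pi : ℂ) ≠ 0 := by exact_mod_cast hpi.ne'
    push_cast
    field_simp

lemma two_mul_re_integral_Ioi {g : ℝ → ℂ} (hg : Integrable g)
    (hsymm : ∀ x, g (-x) = starRingEnd ℂ (g x)) :
    2 * (∫ x in Ioi (0 : ℝ), g x).re = (∫ x, g x).re := by
  have h1 : ∫ x in Iic (0 : ℝ), g x = starRingEnd ℂ (∫ x in Ioi (0 : ℝ), g x) := by
    rw [← integral_conj, ← neg_zero, ← integral_comp_neg_Ioi]
    simp only [hsymm, neg_zero]
  rw [← intervalIntegral.integral_Iic_add_Ioi hg.integrableOn hg.integrableOn (b := 0), h1]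
  simp
  ring

/-- For real φ the integrand is Hermitian, so the real part over a half-line is half of the full
inversion integral. -/
lemma fourier_half_inversion {φ : ℝ → ℝ} (hc : Continuous φ) (hφ : Integrable φ)
    (hF : Integrable (𝓕 fun θ => (φ θ : ℂ))) :
    Real.pi⁻¹ * (∫ ρ in Ioi (0 : ℝ), 𝓕 (fun θ => (φ θ : ℂ)) (ρ / (2 * Real.pi)) *
        Complex.exp (ρ * Complex.I)).re = φ 1 := by
  have hpi := Real.pi_pos
  set f : ℝ → ℂ := fun θ => (φ θ : ℂ) with hf
  have hF' : Integrable fun ρ : ℝ => 𝓕 f (ρ / (2 * Real.pi)) * Complex.exp (ρ * Complex.I) := by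
    refine (hF.comp_div (by positivity : 2 * Real.pi ≠ 0)).mul_bdd (c := 1)
      (Continuous.aestronglyMeasurable (by fun_prop)) (Eventually.of_forall fun q => ?_)
    rw [Complex.norm_exp]; simp
  have h1 := two_mul_re_integral_Ioi hF' (by
    intro x
    rw [map_mul, ← Complex.exp_conj, Real.fourier_real_eq_integral_exp_smul,
      Real.fourier_real_eq_integral_exp_smul, ← integral_conj]
    congr 1
    · congr 1
      ext v
      simp only [smul_eq_mul, map_mul, ← Complex.exp_conj, hf, Complex.conj_ofReal, Complex.conj_I]
      congr 2
      push_cast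
      ring
    · simp)
  have h2 : ∫ ρ : ℝ, 𝓕 f (ρ / (2 * Real.pi)) * Complex.exp (ρ * Complex.I) =
      ((2 * Real.pi : ℝ) : ℂ) * f 1 := by
    have h3 := Measure.integral_comp_div
      (fun ξ : ℝ => 𝓕 f ξ * Complex.exp (((2 * Real.pi * ξ : ℝ) : ℂ) * Complex.I)) (2 * Real.pi)
    have h4 : 𝓕⁻ (𝓕 f) 1 = f 1 := by
      rw [Continuous.fourierInv_fourier_eq (by fun_prop) hφ.ofReal hF]
    rw [Real.fourierInv_eq_fourier_neg, Real.fourier_real_eq_integral_exp_smul] at h4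
    rw [abs_of_pos (by positivity : 0 < 2 * Real.pi)] at h3
    rw [Complex.real_smul] at h3
    rw [← h4]
    calc _ = _ := by
          congr 1
          ext ρ
          rw [mul_div_cancel₀ ρ (by positivity : 2 * Real.pi ≠ 0)]
      _ = _ := h3
      _ = _ := by
          congr 2
          ext ξ
          rw [smul_eq_mul, mul_comm, show -2 * Real.pi * ξ * -1 = 2 * Real.pi * ξ by ring]
  rw [h2, Complex.re_ofReal_mul] at h1
  simp only [hf, Complex.ofReal_re] at h1 ⊢
  rw [inv_mul_eq_div, div_eq_iff hpi.ne']
  linarith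

/-- The ray turns to -i as α → 1, so the limit is the character that evaluates at θ = 1. -/
lemma tendsto_cexp_rotation {ρ : ℝ} (hρ : 0 < ρ) :
    Tendsto (fun α : ℝ => Complex.exp (-(rotation α * ((ρ ^ (1 / α) : ℝ) : ℂ)))) (𝓝[<] 1)
      (𝓝 (Complex.exp (ρ * Complex.I))) := by
  have h1 : ContinuousAt (fun α : ℝ => Complex.exp (-(rotation α * ((ρ ^ (1 / α) : ℝ) : ℂ)))) 1 := by
    have h2 : ContinuousAt (fun α : ℝ => ρ ^ (1 / α)) 1 := by
      refine ContinuousAt.rpow continuousAt_const ?_ (Or.inl hρ.ne')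
      exact ContinuousAt.div continuousAt_const continuousAt_id one_ne_zero
    have h3 : ContinuousAt rotation 1 := by
      unfold rotation
      have : ContinuousAt (fun α : ℝ => Real.pi / (2 * α) - Real.pi) 1 := by
        refine ContinuousAt.sub (ContinuousAt.div continuousAt_const (by fun_prop) ?_)
          continuousAt_const
        norm_num
      fun_prop
    fun_prop
  have h4 := h1.tendsto.mono_left (nhdsWithin_le_nhds (s := Iio 1))
  convert h4 using 3
  have : rotation 1 = -Complex.I := by
    rw [rotation, ← Complex.exp_neg_pi_div_two_mul_I]
    congr 1
    push_cast
    ring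
  rw [this]
  simp [mul_comm]

lemma eventually_mem_Ioo_nhdsLT : ∀ᶠ α : ℝ in 𝓝[<] 1, α ∈ Ioo (1 / 2 : ℝ) 1 :=
  Ioo_mem_nhdsLT (by norm_num)

/-- `h_α → δ_1` as `α → 1-0`, tested against functions with integrable Fourier transform. -/
lemma tendsto_integral_mul_wrightDensity {φ : ℝ → ℝ} (hc : Continuous φ) (hφ : Integrable φ)
    (hF : Integrable (𝓕 fun θ => (φ θ : ℂ))) :
    Tendsto (fun α => ∫ θ, φ θ * wrightDensity α θ) (𝓝[<] 1) (𝓝 (φ 1)) := by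
  have hpi := Real.pi_pos
  have hlim : Tendsto (fun α : ℝ => ∫ ρ in Ioi (0 : ℝ),
      𝓕 (fun θ => (φ θ : ℂ)) (ρ / (2 * Real.pi)) *
        Complex.exp (-(rotation α * ((ρ ^ (1 / α) : ℝ) : ℂ)))) (𝓝[<] 1)
      (𝓝 (∫ ρ in Ioi (0 : ℝ), 𝓕 (fun θ => (φ θ : ℂ)) (ρ / (2 * Real.pi)) *
        Complex.exp (ρ * Complex.I))) := by
    have hFd := hF.comp_div (by positivity : 2 * Real.pi ≠ 0)
    refine tendsto_integral_filter_of_dominated_convergence _ ?_ ?_ hFd.norm.integrableOn ?_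
    · filter_upwards [eventually_mem_Ioo_nhdsLT] with α hα
      exact hFd.aestronglyMeasurable.restrict.mul
        (continuous_cexp_rotation (by linarith [hα.1])).aestronglyMeasurable
    · filter_upwards [eventually_mem_Ioo_nhdsLT] with α hα
      refine (ae_restrict_iff' measurableSet_Ioi).2 (Eventually.of_forall fun ρ hρ => ?_)
      rw [norm_mul, norm_cexp_rotation]
      -- Decay is lost in the limit, but the factor stays bounded by 1, so the integrable Fourier
      -- transform of φ dominates.
      refine mul_le_of_le_one_right (norm_nonneg _) (Real.exp_le_one_iff.2 ?_)
      have := rotation_re_pos hα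
      have : 0 ≤ ρ ^ (1 / α) := Real.rpow_nonneg (le_of_lt hρ) _
      nlinarith
    · refine (ae_restrict_iff' measurableSet_Ioi).2 (Eventually.of_forall fun ρ hρ => ?_)
      exact (tendsto_cexp_rotation hρ).const_mul _
  have h1 : Tendsto (fun α : ℝ => (Real.pi * α)⁻¹) (𝓝[<] 1) (𝓝 Real.pi⁻¹) := by
    have : ContinuousAt (fun α : ℝ => (Real.pi * α)⁻¹) 1 :=
      ContinuousAt.inv₀ (by fun_prop) (by simp)
    simpa using this.tendsto.mono_left (nhdsWithin_le_nhds (s := Iio 1))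
  have h2 := h1.mul ((Complex.continuous_re.tendsto _).comp hlim)
  rw [fourier_half_inversion hc hφ hF] at h2
  refine h2.congr' ?_
  filter_upwards [eventually_mem_Ioo_nhdsLT] with α hα
  exact (integrable_mul_wrightDensity hα hφ).2.symm

/-- Uniform concentration of `h_α` near `θ = 1` as `α → 1-0`. -/
lemma eventually_wrightMass :
    ∀ᶠ α : ℝ in 𝓝[<] 1, WrightMass α (1 / 2) (3 / 2) (1 / 2) := by
  -- A bump with φ(1) = 1 vanishing outside [1/2, 3/2]; being a Schwartz function, it has an
  -- integrable Fourier transform.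
  let φ : ContDiffBump (1 : ℝ) := ⟨1 / 4, 1 / 2, by norm_num, by norm_num⟩
  have hφ1 : φ 1 = 1 := φ.one_of_mem_closedBall (Metric.mem_closedBall_self φ.rIn_pos.le)
  have hcs : HasCompactSupport fun θ => (φ θ : ℂ) :=
    φ.hasCompactSupport.comp_left (g := fun x : ℝ => (x : ℂ)) Complex.ofReal_zero
  have hsm : ContDiff ℝ (⊤ : ℕ∞) fun θ => (φ θ : ℂ) :=
    Complex.ofRealCLM.contDiff.comp φ.contDiff
  have hF : Integrable (𝓕 fun θ => (φ θ : ℂ)) := (𝓕 (hcs.toSchwartzMap hsm)).integrable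
  have hlim := tendsto_integral_mul_wrightDensity φ.continuous φ.integrable hF
  rw [hφ1] at hlim
  filter_upwards [eventually_mem_Ioo_nhdsLT, hlim.eventually_const_lt (by norm_num : (1 / 2 : ℝ) < 1)]
    with α hα hlt
  refine ⟨by norm_num, by norm_num, by norm_num, ?_⟩
  have hint := (integrable_mul_wrightDensity hα φ.integrable).1
  calc ENNReal.ofReal (1 / 2) ≤ ENNReal.ofReal (∫ θ, φ θ * wrightDensity α θ) :=
        ENNReal.ofReal_le_ofReal hlt.le
    -- Passing to the positive part avoids any appeal to the sign of h_α.
    _ ≤ ENNReal.ofReal (∫ θ, max (φ θ * wrightDensity α θ) 0) :=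
        ENNReal.ofReal_le_ofReal (integral_mono hint hint.pos_part fun θ => le_max_left _ _)
    _ = ∫⁻ θ, ENNReal.ofReal (max (φ θ * wrightDensity α θ) 0) :=
        ofReal_integral_eq_lintegral_ofReal hint.pos_part
          (Eventually.of_forall fun θ => le_max_right _ _)
    _ ≤ ∫⁻ θ, (Icc (1 / 2 : ℝ) (3 / 2)).indicator
          (fun θ => ENNReal.ofReal (wrightDensity α θ)) θ := by
        refine lintegral_mono fun θ => ?_
        by_cases hθ : θ ∈ Icc (1 / 2 : ℝ) (3 / 2)
        · rw [indicator_of_mem hθ, ENNReal.ofReal_max, ENNReal.ofReal_zero, max_eq_left zero_le,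
            ENNReal.ofReal_mul φ.nonneg]
          exact mul_le_of_le_one_left zero_le (ENNReal.ofReal_le_one.2 φ.le_one)
        · have : φ θ = 0 := by
            refine φ.zero_of_le_dist ?_
            show 1 / 2 ≤ dist θ 1
            rw [Real.dist_eq]
            by_contra hcon
            push Not at hcon
            rw [abs_lt] at hcon
            exact hθ ⟨by linarith [hcon.1], by linarith [hcon.2]⟩
          simp [this]
    _ = _ := lintegral_indicator measurableSet_Icc _

/-! ### Mass of h_α near θ = 0 for a fixed α. -/

lemma Gamma_le_max {α x y : ℝ} (hα : 0 < α) (hx : x ∈ Icc α y) :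
    Real.Gamma x ≤ max (Real.Gamma α) (Real.Gamma y) :=
  Real.convexOn_Gamma.le_max_of_mem_Icc hα (hα.trans_le (hx.1.trans hx.2)) hx

/-- Since `h_α(0) = 1/Γ(1-α) > 0`, the density is positive near `0`. -/
lemma exists_wrightMass {α : ℝ} (hα : α ∈ Ioo (0 : ℝ) 1) : ∃ a b c, WrightMass α a b c := by
  obtain ⟨hα0, hα1⟩ := hα
  have hpi := Real.pi_pos
  set C := Real.Gamma α + 1 with hC
  have hGα : 0 < Real.Gamma α := Real.Gamma_pos_of_pos hα0
  have hterm : ∀ (θ : ℝ) (k : ℕ),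
      |(-θ) ^ k / ((k.factorial : ℝ) * Real.Gamma (1 - α - α * k))| ≤ C * |θ| ^ k := by
    intro θ k
    have hk1 : (1 : ℝ) ≤ k.factorial := by exact_mod_cast k.factorial_pos
    -- Convexity of Γ on [α, k+1] bounds it by its endpoint values Γ(α) and k!; the series is then
    -- dominated by a geometric one.
    have hG : Real.Gamma (α * (k + 1)) ≤ C * k.factorial := by
      have h1 := Gamma_le_max (x := α * (k + 1)) (y := k + 1) hα0
        ⟨by nlinarith [Nat.cast_nonneg (α := ℝ) k], by nlinarith [Nat.cast_nonneg (α := ℝ) k]⟩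
      rw [Real.Gamma_nat_eq_factorial] at h1
      refine h1.trans (max_le ?_ ?_) <;> nlinarith
    have hGp : 0 < Real.Gamma (α * (k + 1)) := Real.Gamma_pos_of_pos (by positivity)
    rw [wrightDensity_term hα0, abs_mul, abs_div, abs_pow, abs_neg, abs_div, abs_mul,
      abs_of_pos hGp, abs_of_pos hpi, Nat.abs_cast]
    have h2 : Real.Gamma (α * (k + 1)) * |Real.sin (Real.pi * (α * (k + 1)))| / Real.pi ≤
        C * k.factorial := by
      rw [div_le_iff₀ hpi]
      calc _ ≤ C * k.factorial * 1 := mul_le_mul hG (Real.abs_sin_le_one _) (abs_nonneg _)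
            (by positivity)
        _ ≤ _ := by gcongr; linarith [Real.pi_gt_three]
    calc _ ≤ |θ| ^ k / k.factorial * (C * k.factorial) := by gcongr
      _ = _ := by field_simp
  set d := (Real.Gamma (1 - α))⁻¹ with hd
  have hd0 : 0 < d := inv_pos.2 (Real.Gamma_pos_of_pos (by linarith))
  -- For θ ≤ ε the terms beyond k = 0 add up to at most Cθ/(1-θ) ≤ 2Cθ ≤ d/2, half of h_α(0) = d.
  set ε := min (1 / 2) (d / (4 * C)) with hε
  have hε0 : 0 < ε := by positivity
  have hlow : ∀ θ ∈ Icc (ε / 2) ε, d / 2 ≤ wrightDensity α θ := by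
    intro θ hθ
    have hθ0 : 0 < θ := by linarith [hθ.1]
    have hθ2 : θ ≤ 1 / 2 := hθ.2.trans (min_le_left _ _)
    have hθ3 : θ ≤ d / (4 * C) := hθ.2.trans (min_le_right _ _)
    have hgeo : Summable fun k : ℕ => C * |θ| ^ k :=
      (summable_geometric_of_abs_lt_one (by rw [abs_abs, abs_of_pos hθ0]; linarith)).mul_left C
    have hsum : Summable fun k : ℕ =>
        (-θ) ^ k / ((k.factorial : ℝ) * Real.Gamma (1 - α - α * k)) :=
      Summable.of_norm_bounded hgeo fun k => by rw [Real.norm_eq_abs]; exact hterm θ k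
    have hgs : HasSum (fun k : ℕ => C * |θ| ^ (k + 1)) (C * (θ * (1 - θ)⁻¹)) := by
      have := ((hasSum_geometric_of_lt_one hθ0.le (by linarith : θ < 1)).mul_left θ).mul_left C
      simp only [abs_of_pos hθ0, pow_succ']
      exact this
    have htail := tsum_of_norm_bounded hgs fun k : ℕ => (by
      rw [Real.norm_eq_abs]; exact hterm θ (k + 1))
    rw [wrightDensity, hsum.tsum_eq_zero_add]
    have hinv : (1 - θ)⁻¹ ≤ 2 := by
      rw [inv_le_comm₀ (by linarith) (by norm_num)]; linarith
    have hsmall : C * (θ * (1 - θ)⁻¹) ≤ d / 2 := by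
      rw [le_div_iff₀ (by positivity)] at hθ3
      have : θ * (1 - θ)⁻¹ ≤ θ * 2 := by gcongr
      have : C * (θ * (1 - θ)⁻¹) ≤ C * (θ * 2) := by gcongr
      linarith
    rw [Real.norm_eq_abs] at htail
    have h0 : (-θ) ^ 0 / (((0 : ℕ).factorial : ℝ) * Real.Gamma (1 - α - α * (0 : ℕ))) = d := by
      simp [hd]
    rw [h0]
    have := (abs_le.1 htail).1
    linarith
  refine ⟨ε / 2, ε, d / 2 * (ε / 2), by positivity, hε0, by positivity, ?_⟩
  calc _ = ∫⁻ _ in Icc (ε / 2) ε, ENNReal.ofReal (d / 2) := by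
        rw [setLIntegral_const, Real.volume_Icc, ← ENNReal.ofReal_mul (by positivity)]
        congr 1; ring
    _ ≤ _ := setLIntegral_mono' measurableSet_Icc fun θ hθ =>
        ENNReal.ofReal_le_ofReal (hlow θ hθ)

/-! ### Amplification on parabolic cylinders and blow-up. -/

section LowerBounds

variable {N : ℕ} {α₀ α a b c p T : ℝ} {μ : Measure (EuclideanSpace ℝ (Fin N))}
  {u : ℝ → EuclideanSpace ℝ (Fin N) → ℝ≥0∞}

lemma IsSolution.opP_le (hu : IsSolution α p T μ u) :
    ∀ᵐ t ∂(volume.restrict (Ioc (0 : ℝ) T)), ∀ᵐ x, opP α t μ x ≤ u t x := by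
  filter_upwards [hu.eq] with t ht
  filter_upwards [ht] with x hx
  rw [hx]
  exact le_self_add

lemma IsSolution.duhamel_le (hu : IsSolution α p T μ u) :
    ∀ᵐ t ∂(volume.restrict (Ioc (0 : ℝ) T)), ∀ᵐ x, ENNReal.ofReal α *
      ∫⁻ s in Ioo (0 : ℝ) t, ENNReal.ofReal ((t - s) ^ (α - 1)) *
        opS α (t - s) (volume.withDensity fun y => u s y ^ p) x ≤ u t x := by
  filter_upwards [hu.eq] with t ht
  filter_upwards [ht] with x hx
  rw [hx]
  exact le_add_self

/-- In the Duhamel integral over (t₁,t) the weight is at least (t-t₁)^{α-1} and `opS_ball_lower`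
bounds the rest below by a constant, which produces the factor (t-t₁)^α. -/
lemma IsSolution.amplify_ball (hu : IsSolution α p T μ u) (h : WrightMass α a b c)
    (hα₀ : 0 < α₀) (hα : α₀ ≤ α) (hα1 : α < 1) (hp : 0 ≤ p) {A ρ t₁ t₂ t' : ℝ} (hA : 0 ≤ A)
    (ht₁ : 0 ≤ t₁) (ht₂ : t₂ ≤ T) (hρ : 0 < ρ) (hδ : (t₂ - t₁) ^ α ≤ ρ ^ 2) (ht' : t₁ ≤ t')
    {z : EuclideanSpace ℝ (Fin N)}
    (H : ∀ᵐ t ∂(volume.restrict (Ioo t₁ t₂)), ∀ᵐ x ∂(volume.restrict (Metric.ball z ρ)),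
      ENNReal.ofReal A ≤ u t x) :
    ∀ᵐ t ∂(volume.restrict (Ioo t' t₂)), ∀ᵐ x ∂(volume.restrict (Metric.ball z ρ)),
      ENNReal.ofReal (ampConst N α₀ a b c * (t' - t₁) ^ α * A ^ p) ≤ u t x := by
  have hα0 : 0 < α := hα₀.trans_le hα
  have hsub : Ioo t' t₂ ⊆ Ioc 0 T := fun t ht =>
    ⟨ht₁.trans_lt (ht'.trans_lt ht.1), ht.2.le.trans ht₂⟩
  filter_upwards [ae_restrict_of_ae_restrict_of_subset hsub hu.duhamel_le,
    ae_restrict_mem measurableSet_Ioo] with t htu ht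
  filter_upwards [ae_restrict_of_ae htu, ae_restrict_mem measurableSet_ball] with x hxu hx
  refine le_trans ?_ hxu
  have hκ1 : 0 < ampConst N 1 a b c := ampConst_pos N h one_pos
  have hκ : ampConst N α₀ a b c = α₀ * ampConst N 1 a b c := by unfold ampConst; ring
  have htt : 0 < t - t₁ := by linarith [ht.1]
  have hAp : 0 ≤ A ^ p := Real.rpow_nonneg hA p
  calc ENNReal.ofReal (ampConst N α₀ a b c * (t' - t₁) ^ α * A ^ p)
      ≤ ENNReal.ofReal (α * ((t - t₁) ^ (α - 1) * (ampConst N 1 a b c * A ^ p) * (t - t₁))) := by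
        apply ENNReal.ofReal_le_ofReal
        have h1 : (t' - t₁) ^ α ≤ (t - t₁) ^ α :=
          Real.rpow_le_rpow (by linarith) (by linarith [ht.1]) hα0.le
        have h2 : (t - t₁) ^ α = (t - t₁) ^ (α - 1) * (t - t₁) := by
          rw [← Real.rpow_add_one htt.ne']; congr 1; ring
        calc _ = α₀ * (t' - t₁) ^ α * (ampConst N 1 a b c * A ^ p) := by rw [hκ]; ring
          _ ≤ α * (t - t₁) ^ α * (ampConst N 1 a b c * A ^ p) := by
            gcongr
          _ = _ := by rw [h2]; ring
    _ = ENNReal.ofReal α * ∫⁻ _ in Ioo t₁ t,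
          ENNReal.ofReal ((t - t₁) ^ (α - 1)) * ENNReal.ofReal (ampConst N 1 a b c * A ^ p) := by
        rw [setLIntegral_const, Real.volume_Ioo, ← ENNReal.ofReal_mul (by positivity),
          ← ENNReal.ofReal_mul (by positivity), ← ENNReal.ofReal_mul (by positivity)]
    _ ≤ ENNReal.ofReal α * ∫⁻ s in Ioo t₁ t, ENNReal.ofReal ((t - s) ^ (α - 1)) *
        opS α (t - s) (volume.withDensity fun y => u s y ^ p) x := by
        gcongr ENNReal.ofReal α * ?_
        refine lintegral_mono_ae ?_
        filter_upwards [ae_restrict_of_ae_restrict_of_subset (Ioo_subset_Ioo_right ht.2.le) H,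
          ae_restrict_mem measurableSet_Ioo] with s hs hs'
        have hts : 0 < t - s := by linarith [hs'.2]
        refine mul_le_mul' (ENNReal.ofReal_le_ofReal ?_) ?_
        · exact Real.rpow_le_rpow_of_nonpos hts (by linarith [hs'.1]) (by linarith)
        · refine opS_ball_lower h hp hA hts (le_trans ?_ hδ) hρ hx hs
          exact Real.rpow_le_rpow hts.le (by linarith [hs'.1, ht.2]) hα0.le
    _ ≤ _ := by
        gcongr ENNReal.ofReal α * ?_
        exact lintegral_mono_set (Ioo_subset_Ioo_left ht₁)

/-- A solution cannot be too large on a parabolic cylinder. -/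
lemma IsSolution.ball_bound (hu : IsSolution α p T μ u) (h : WrightMass α a b c)
    (hα₀ : 0 < α₀) (hα : α₀ ≤ α) (hα1 : α < 1) (hp : 1 < p) {A ρ t₁ t₂ : ℝ} (hA : 0 ≤ A)
    (ht₁ : 0 ≤ t₁) (ht₂ : t₂ ≤ T) (ht : t₁ < t₂) (hρ : 0 < ρ) (hδ : (t₂ - t₁) ^ α ≤ ρ ^ 2)
    {z : EuclideanSpace ℝ (Fin N)}
    (H : ∀ᵐ t ∂(volume.restrict (Ioo t₁ t₂)), ∀ᵐ x ∂(volume.restrict (Metric.ball z ρ)),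
      ENNReal.ofReal A ≤ u t x) :
    ampConst N α₀ a b c * (t₂ - t₁) ^ α * A ^ (p - 1) ≤ 4 * 2 ^ (1 / (p - 1)) := by
  by_contra hcon
  push Not at hcon
  have hα0 : 0 < α := hα₀.trans_le hα
  have hp1 : 0 < p - 1 := by linarith
  set κ := ampConst N α₀ a b c with hκ
  have hκ0 : 0 < κ := ampConst_pos N h hα₀
  -- With this ratio l^p = 2l: each use of the power p gains 2^k beyond l^k, which pays for time
  -- steps shrinking like 2^{-k}.
  set l : ℝ := 2 ^ (1 / (p - 1)) with hl
  have hl0 : 0 < l := by positivity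
  have hl1 : 1 < l := Real.one_lt_rpow (by norm_num) (by positivity)
  have hlp : l ^ p = l * 2 := by
    have : l ^ (p - 1) = 2 := by
      rw [hl, ← Real.rpow_mul (by norm_num), one_div_mul_cancel hp1.ne', Real.rpow_one]
    rw [show p = 1 + (p - 1) by ring, Real.rpow_add hl0, Real.rpow_one, this]
  have hA0 : 0 < A := by
    rcases hA.eq_or_lt with h0 | h0
    · rw [← h0, Real.zero_rpow hp1.ne', mul_zero] at hcon
      linarith
    · exact h0
  set δ := t₂ - t₁ with hδdef
  have hδ0 : 0 < δ := by linarith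
  -- All steps fit in the first half of the interval, so every bound A l^k holds on the second half.
  let τ : ℕ → ℝ := fun k => t₁ + δ / 2 * (1 - (1 / 2) ^ k)
  have hτ : ∀ k, t₁ ≤ τ k ∧ τ k ≤ t₁ + δ / 2 := by
    intro k
    have h1 : (0 : ℝ) < (1 / 2) ^ k := by positivity
    have h2 : ((1 : ℝ) / 2) ^ k ≤ 1 := pow_le_one₀ (by norm_num) (by norm_num)
    constructor <;> simp only [τ] <;> nlinarith
  have hstep : ∀ k, ∀ᵐ t ∂(volume.restrict (Ioo (τ k) t₂)),
      ∀ᵐ x ∂(volume.restrict (Metric.ball z ρ)), ENNReal.ofReal (A * l ^ k) ≤ u t x := by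
    intro k
    induction k with
    | zero => simpa [τ] using H
    | succ k ih =>
      have hdiff : τ (k + 1) - τ k = δ * (1 / 2) ^ (k + 2) := by
        simp only [τ]; ring
      have h1 := hu.amplify_ball h hα₀ hα hα1 (by linarith) (by positivity)
        (ht₁.trans (hτ k).1) ht₂ hρ
        ((Real.rpow_le_rpow (by linarith [(hτ k).2]) (by linarith [(hτ k).1]) hα0.le).trans hδ)
        (by have : 0 < δ * (1 / 2) ^ (k + 2) := by positivity
            linarith : τ k ≤ τ (k + 1)) ih
      filter_upwards [h1] with t ht1
      filter_upwards [ht1] with x hx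
      refine le_trans (ENNReal.ofReal_le_ofReal ?_) hx
      rw [hdiff, Real.mul_rpow hδ0.le (by positivity), Real.mul_rpow hA0.le (by positivity)]
      have h2 : (l ^ k) ^ p = l ^ k * 2 ^ k := by
        rw [← Real.rpow_natCast l k, ← Real.rpow_mul hl0.le, mul_comm, Real.rpow_mul hl0.le, hlp,
          Real.rpow_natCast, mul_pow, Real.rpow_natCast]
      -- Here α < 1 makes the loss from short steps no worse than for α = 1, so the threshold does
      -- not depend on α.
      have h3 : ((1 : ℝ) / 2) ^ (k + 2) ≤ (((1 : ℝ) / 2) ^ (k + 2)) ^ α := by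
        conv_lhs => rw [← Real.rpow_one (((1 : ℝ) / 2) ^ (k + 2))]
        exact Real.rpow_le_rpow_of_exponent_ge (by positivity)
          (pow_le_one₀ (by norm_num) (by norm_num)) hα1.le
      have h4 : A ^ p = A ^ (p - 1) * A := by
        rw [← Real.rpow_add_one hA0.ne']; congr 1; ring
      have h5 : ((1 : ℝ) / 2) ^ (k + 2) * 2 ^ k = 1 / 4 := by
        rw [pow_add, mul_right_comm, ← mul_pow]; norm_num
      rw [h2, h4]
      calc A * l ^ (k + 1) = (4 * l) * (A * l ^ k * (1 / 4)) := by ring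
        _ ≤ (κ * δ ^ α * A ^ (p - 1)) * (A * l ^ k * (1 / 4)) := by gcongr
        _ = κ * (δ ^ α * ((1 : ℝ) / 2) ^ (k + 2)) * (A ^ (p - 1) * A * (l ^ k * 2 ^ k)) := by
            rw [← h5]; ring
        _ ≤ _ := by gcongr
  have hall : ∀ᵐ t ∂(volume.restrict (Ioo (t₁ + δ / 2) t₂)),
      ∀ᵐ x ∂(volume.restrict (Metric.ball z ρ)), False := by
    have h1 : ∀ᵐ t ∂(volume.restrict (Ioo (t₁ + δ / 2) t₂)), ∀ k,
        ∀ᵐ x ∂(volume.restrict (Metric.ball z ρ)), ENNReal.ofReal (A * l ^ k) ≤ u t x :=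
      ae_all_iff.2 fun k => ae_restrict_of_ae_restrict_of_subset
        (Ioo_subset_Ioo_left (hτ k).2) (hstep k)
    have hsub : Ioo (t₁ + δ / 2) t₂ ⊆ Ioc 0 T := fun t ht => ⟨by linarith [ht.1], by linarith [ht.2]⟩
    filter_upwards [h1, ae_restrict_of_ae_restrict_of_subset hsub hu.finite] with t ht1 htf
    filter_upwards [ae_all_iff.2 ht1, ae_restrict_of_ae htf] with x hx hxf
    have hlim : Tendsto (fun k : ℕ => A * l ^ k) atTop atTop :=
      (tendsto_pow_atTop_atTop_of_one_lt hl1).const_mul_atTop hA0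
    obtain ⟨k, hk⟩ := (hlim.eventually_gt_atTop (u t x).toReal).exists
    have := (ENNReal.ofReal_le_iff_le_toReal hxf.ne).1 (hx k)
    linarith
  have hne1 : volume (Metric.ball z ρ) ≠ 0 := (Metric.measure_ball_pos _ _ hρ).ne'
  have hne2 : volume (Ioo (t₁ + δ / 2) t₂) ≠ 0 := by
    rw [Real.volume_Ioo, ne_eq, ENNReal.ofReal_eq_zero, not_le]
    linarith
  have : ∀ᵐ t ∂(volume.restrict (Ioo (t₁ + δ / 2) t₂)), False := by
    filter_upwards [hall] with t ht1
    simp [ae_iff, hne1] at ht1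
  rw [ae_iff] at this
  simp only [not_false_eq_true, ofPred_true, Measure.restrict_apply_univ] at this
  exact hne2 this

end LowerBounds

/-! ### The growth bound for every p > 1. -/

/-- Growth bound for the initial measure, with a constant depending on `α` only through
`WrightMass`. -/
lemma exists_growth_bound (N : ℕ) {p α₀ a b c : ℝ} (hp : 1 < p) (hα₀ : 0 < α₀)
    (hb : 0 < b) (ha : 0 < a) (hc : 0 < c) :
    ∃ γ : ℝ, 0 < γ ∧ ∀ α, α₀ ≤ α → α < 1 → WrightMass α a b c → ∀ T : ℝ, 0 < T →
      ∀ μ : Measure (EuclideanSpace ℝ (Fin N)), IsLocallyFiniteMeasure μ →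
        (∃ u, IsSolution α p T μ u) → ∀ σ ∈ Ioc (0 : ℝ) (T ^ (α / 2)), ∀ z,
          (μ (Metric.ball z σ)).toReal ≤ γ * σ ^ ((N : ℝ) - 2 / (p - 1)) := by
  set g := gaussConst N a b with hg
  have hg0 : 0 < g := gaussConst_pos N hb
  set κ := ampConst N α₀ a b c with hκ
  have hκ0 : 0 < κ := by
    have := unitBallVolume_pos N
    rw [hκ]; unfold ampConst; positivity
  set Λ : ℝ := 4 * 2 ^ (1 / (p - 1)) with hΛ
  have hΛ0 : 0 < Λ := by positivity
  have hp1 : 0 < p - 1 := by linarith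
  refine ⟨(2 * Λ / κ) ^ (1 / (p - 1)) / (c * g), by positivity, ?_⟩
  rintro α hα hα1 h T hT μ hμ ⟨u, hu⟩ σ ⟨hσ, hσT⟩ z
  have hα0 : 0 < α := hα₀.trans_le hα
  -- The time with τ^α = σ²; the restriction on σ says exactly that τ ≤ T.
  set τ := σ ^ (2 / α) with hτ
  have hτ0 : 0 < τ := by positivity
  have hτα : τ ^ α = σ ^ 2 := by
    rw [hτ, ← Real.rpow_mul hσ.le, div_mul_cancel₀ _ hα0.ne', Real.rpow_two]
  have hτT : τ ≤ T := by
    have h1 : σ ^ (2 / α) ≤ (T ^ (α / 2)) ^ (2 / α) := Real.rpow_le_rpow hσ.le hσT (by positivity)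
    rw [← Real.rpow_mul hT.le, show α / 2 * (2 / α) = 1 by field_simp, Real.rpow_one] at h1
    exact h1
  have hhalf : σ ^ 2 / 2 ≤ (τ / 2) ^ α := by
    rw [Real.div_rpow hτ0.le (by norm_num), hτα]
    have : (2 : ℝ) ^ α ≤ 2 ^ (1 : ℝ) := Real.rpow_le_rpow_of_exponent_le (by norm_num) hα1.le
    rw [Real.rpow_one] at this
    gcongr
  set M := (μ (Metric.ball z σ)).toReal with hM
  have hM0 : 0 ≤ M := ENNReal.toReal_nonneg
  have hMμ : ENNReal.ofReal M = μ (Metric.ball z σ) := ENNReal.ofReal_toReal measure_ball_lt_top.ne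
  have H : ∀ᵐ t ∂(volume.restrict (Ioo (τ / 2) τ)), ∀ᵐ x ∂(volume.restrict (Metric.ball z σ)),
      ENNReal.ofReal (c * g / σ ^ N * M) ≤ u t x := by
    have hsub : Ioo (τ / 2) τ ⊆ Ioc 0 T := fun t ht => ⟨by linarith [ht.1], by linarith [ht.2]⟩
    filter_upwards [ae_restrict_of_ae_restrict_of_subset hsub hu.opP_le,
      ae_restrict_mem measurableSet_Ioo] with t htu ht
    filter_upwards [ae_restrict_of_ae htu, ae_restrict_mem measurableSet_ball] with x hxu hx
    refine le_trans ?_ hxu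
    rw [ENNReal.ofReal_mul (by positivity), hMμ]
    refine opP_lower h hσ (hhalf.trans ?_) ?_ μ measurableSet_ball ?_
    · exact Real.rpow_le_rpow (by positivity) ht.1.le hα0.le
    · rw [← hτα]
      exact Real.rpow_le_rpow (by linarith [ht.1]) ht.2.le hα0.le
    · intro y hy
      rw [← dist_eq_norm]
      have h1 := Metric.mem_ball.1 hx
      have h2 := Metric.mem_ball'.1 hy
      linarith [dist_triangle x z y]
  have key := hu.ball_bound h hα₀ hα hα1 hp (by positivity) (by positivity) hτT (by linarith) hσ
    (by rw [← hτα]; exact Real.rpow_le_rpow (by linarith) (by linarith) hα0.le) H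
  rw [show τ - τ / 2 = τ / 2 by ring] at key
  set Y := c * g / σ ^ N * M with hY
  have hY0 : 0 ≤ Y := by positivity
  have h1 : Y ^ (p - 1) ≤ 2 * Λ / κ / σ ^ 2 := by
    have h2 : κ * (σ ^ 2 / 2) * Y ^ (p - 1) ≤ Λ := le_trans (by gcongr) key
    rw [div_div, le_div_iff₀ (by positivity)]
    nlinarith
  have h3 : Y ≤ (2 * Λ / κ / σ ^ 2) ^ (1 / (p - 1)) := by
    have := Real.rpow_le_rpow (by positivity) h1 (by positivity : 0 ≤ 1 / (p - 1))
    rwa [← Real.rpow_mul hY0, mul_one_div_cancel hp1.ne', Real.rpow_one] at this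
  have h4 : (σ ^ 2) ^ (1 / (p - 1)) = σ ^ (2 / (p - 1)) := by
    rw [← Real.rpow_natCast, ← Real.rpow_mul hσ.le]; congr 1; push_cast; ring
  rw [Real.div_rpow (by positivity) (by positivity), h4] at h3
  rw [Real.rpow_sub hσ, Real.rpow_natCast]
  calc M = Y * (σ ^ N / (c * g)) := by rw [hY]; field_simp
    _ ≤ (2 * Λ / κ) ^ (1 / (p - 1)) / σ ^ (2 / (p - 1)) * (σ ^ N / (c * g)) := by gcongr
    _ = _ := by ring

/-! ### The critical exponent. -/

lemma ofReal_le_lintegral_rpow_neg {α x y : ℝ} (hα : α < 1) (hx : 0 < x) (hy : 0 ≤ y) :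
    ENNReal.ofReal ((y ^ (1 - α) - x ^ (1 - α)) / (1 - α)) ≤
      ∫⁻ s in Ioo x y, ENNReal.ofReal (s ^ (-α)) := by
  rcases le_total y x with hyx | hxy
  · have h1 : y ^ (1 - α) ≤ x ^ (1 - α) := Real.rpow_le_rpow hy hyx (by linarith)
    rw [ENNReal.ofReal_of_nonpos (div_nonpos_of_nonpos_of_nonneg (by linarith) (by linarith))]
    exact zero_le
  · have h1 := integral_rpow (a := x) (b := y) (r := -α) (Or.inl (by linarith))
    rw [show -α + 1 = 1 - α by ring] at h1
    have hint : IntervalIntegrable (fun s : ℝ => s ^ (-α)) volume x y :=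
      intervalIntegral.intervalIntegrable_rpow' (by linarith)
    rw [← h1, intervalIntegral.integral_of_le hxy, integral_Ioc_eq_integral_Ioo]
    have hint' : IntegrableOn (fun s : ℝ => s ^ (-α)) (Ioo x y) :=
      ((intervalIntegrable_iff_integrableOn_Ioc_of_le hxy).1 hint).mono_set Ioo_subset_Ioc_self
    rw [ofReal_integral_eq_lintegral_ofReal hint']
    exact (ae_restrict_iff' measurableSet_Ioo).2 (Eventually.of_forall fun s hs =>
      Real.rpow_nonneg (hx.trans hs.1).le _)

section Critical

variable {N : ℕ} {α₀ α a b c T : ℝ} {μ : Measure (EuclideanSpace ℝ (Fin N))}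
  {u : ℝ → EuclideanSpace ℝ (Fin N) → ℝ≥0∞} {z : EuclideanSpace ℝ (Fin N)}

/-- `u(t,x) ≥ A t^{-αN/2}` for almost all `t ∈ (t',T)` and `|x - z| < t^{α/2}`. -/
def SelfSimilarLower (u : ℝ → EuclideanSpace ℝ (Fin N) → ℝ≥0∞) (z : EuclideanSpace ℝ (Fin N))
    (α T A t' : ℝ) : Prop :=
  ∀ᵐ t ∂(volume.restrict (Ioo t' T)), ∀ᵐ x ∂(volume.restrict (Metric.ball z (t ^ (α / 2)))),
    ENNReal.ofReal (A / (t ^ (α / 2)) ^ N) ≤ u t x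

lemma rpow_half_sq {t : ℝ} (ht : 0 ≤ t) (α : ℝ) : (t ^ (α / 2)) ^ 2 = t ^ α := by
  rw [← Real.rpow_natCast, ← Real.rpow_mul ht]; congr 1; push_cast; ring

lemma pow_rpow_two_div (hN : 1 ≤ N) {r : ℝ} (hr : 0 ≤ r) : (r ^ N) ^ (2 / (N : ℝ)) = r ^ 2 := by
  have hN0 : (N : ℝ) ≠ 0 := by positivity
  rw [← Real.rpow_natCast, ← Real.rpow_mul hr, mul_div_cancel₀ _ hN0, Real.rpow_two]

lemma half_rpow_ge {t : ℝ} (ht : 0 ≤ t) (hα1 : α < 1) : t ^ α / 2 ≤ (t / 2) ^ α := by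
  rw [Real.div_rpow ht (by norm_num)]
  have : (2 : ℝ) ^ α ≤ 2 ^ (1 : ℝ) := Real.rpow_le_rpow_of_exponent_le (by norm_num) hα1.le
  rw [Real.rpow_one] at this
  gcongr

lemma fujitaExponent_sub_one : fujitaExponent N - 1 = 2 / (N : ℝ) := by
  unfold fujitaExponent; ring

lemma one_lt_fujitaExponent (hN : 1 ≤ N) : 1 < fujitaExponent N := by
  have : (0 : ℝ) < N := by exact_mod_cast hN
  have : 0 < 2 / (N : ℝ) := by positivity
  unfold fujitaExponent
  linarith

/-- At the critical power the profile satisfies ∫ u(s)^p ≥ const·A^p s^{-α} over |y - z| < s^{α/2}.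
Restricting to s < t/2 keeps t - s comparable to t, so the kernel is at least a multiple of
t^{-αN/2} and the profile reappears times t^{α-1} ∫ s^{-α} ds. -/
lemma IsSolution.amplify_selfSimilar (hu : IsSolution α (fujitaExponent N) T μ u)
    (h : WrightMass α a b c) (hN : 1 ≤ N) (hα₀ : 0 < α₀) (hα : α₀ ≤ α) (hα1 : α < 1)
    {A B t' t'' : ℝ} (hA : 0 ≤ A) (ht' : 0 < t') (ht'' : t' ≤ t'')
    (hB : ∀ t ∈ Ioo t'' T, B ≤ ampConst N α₀ a b c * A ^ fujitaExponent N *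
      (t ^ (α - 1) * (((t / 2) ^ (1 - α) - t' ^ (1 - α)) / (1 - α))))
    (H : SelfSimilarLower u z α T A t') : SelfSimilarLower u z α T B t'' := by
  have hα0 : 0 < α := hα₀.trans_le hα
  have hsub : Ioo t'' T ⊆ Ioc 0 T := fun t ht => ⟨by linarith [ht.1], ht.2.le⟩
  set p := fujitaExponent N with hp
  have hp0 : 0 ≤ p := by rw [hp]; unfold fujitaExponent; positivity
  unfold SelfSimilarLower
  filter_upwards [ae_restrict_of_ae_restrict_of_subset hsub hu.duhamel_le,
    ae_restrict_mem measurableSet_Ioo] with t htu ht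
  filter_upwards [ae_restrict_of_ae htu, ae_restrict_mem measurableSet_ball] with x hxu hx
  refine le_trans ?_ hxu
  have ht0 : 0 < t := by linarith [ht.1]
  set R := t ^ (α / 2) with hR
  have hR0 : 0 < R := by positivity
  have hR2 : R ^ 2 = t ^ α := rpow_half_sq ht0.le α
  have hκ1 : 0 < ampConst N 1 a b c := ampConst_pos N h one_pos
  have hκ : ampConst N α₀ a b c = α₀ * ampConst N 1 a b c := by unfold ampConst; ring
  set κ := ampConst N 1 a b c with hκdef
  have hg := gaussConst_pos N (a := a) h.b_pos
  have ha := h.a_pos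
  have hc := h.c_pos
  have hv := unitBallVolume_pos N
  have hAp : 0 ≤ A ^ p := Real.rpow_nonneg hA p
  set L := ((t / 2) ^ (1 - α) - t' ^ (1 - α)) / (1 - α) with hL
  set W := t ^ (α - 1) * (κ * A ^ p / R ^ N) with hW
  have hW0 : 0 ≤ W := by positivity
  calc ENNReal.ofReal (B / R ^ N)
      ≤ ENNReal.ofReal (α₀ * W * L) := by
        apply ENNReal.ofReal_le_ofReal
        rw [div_le_iff₀ (by positivity)]
        refine (hB t ht).trans (le_of_eq ?_)
        rw [hκ, hW, ← hL]; field_simp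
    _ = ENNReal.ofReal α₀ * (ENNReal.ofReal W * ENNReal.ofReal L) := by
        rw [ENNReal.ofReal_mul (by positivity), ENNReal.ofReal_mul hα₀.le, mul_assoc]
    _ ≤ ENNReal.ofReal α * (ENNReal.ofReal W *
          ∫⁻ s in Ioo t' (t / 2), ENNReal.ofReal (s ^ (-α))) := by
        refine mul_le_mul' (ENNReal.ofReal_le_ofReal hα) ?_
        exact mul_le_mul_right (ofReal_le_lintegral_rpow_neg hα1 ht' (by positivity)) _
    _ ≤ ENNReal.ofReal α *
          ∫⁻ s in Ioo t' (t / 2), ENNReal.ofReal W * ENNReal.ofReal (s ^ (-α)) := by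
        gcongr
        exact lintegral_const_mul_le _ _
    _ ≤ ENNReal.ofReal α * ∫⁻ s in Ioo t' (t / 2), ENNReal.ofReal ((t - s) ^ (α - 1)) *
        opS α (t - s) (volume.withDensity fun y => u s y ^ p) x := by
        gcongr ENNReal.ofReal α * ?_
        refine lintegral_mono_ae ?_
        have hsub' : Ioo t' (t / 2) ⊆ Ioo t' T := Ioo_subset_Ioo_right (by linarith [ht.2])
        filter_upwards [ae_restrict_of_ae_restrict_of_subset hsub' H,
          ae_restrict_mem measurableSet_Ioo] with s hs hs'
        have hs0 : 0 < s := ht'.trans hs'.1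
        have hts : 0 < t - s := by linarith [hs'.2]
        set r := s ^ (α / 2) with hr
        have hr0 : 0 < r := by positivity
        have hrR : r ≤ R := Real.rpow_le_rpow hs0.le (by linarith [hs'.2]) (by positivity)
        have h1 := withDensity_ball_lower (p := p) (A := A / r ^ N) hp0 (by positivity) hr0
          (Subset.refl (Metric.ball z r)) hs
        have h2 := opS_lower h hR0 (t := t - s) (x := x) (B := Metric.ball z r)
          (by
            rw [hR2]
            refine (half_rpow_ge ht0.le hα1).trans ?_
            exact Real.rpow_le_rpow (by positivity) (by linarith [hs'.2]) hα0.le)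
          (by
            rw [hR2]
            exact Real.rpow_le_rpow hts.le (by linarith) hα0.le)
          (volume.withDensity fun y => u s y ^ p) measurableSet_ball (by
            intro y hy
            rw [← dist_eq_norm]
            have h1 := Metric.mem_ball.1 hx
            have h2 := Metric.mem_ball'.1 hy
            linarith [dist_triangle x z y])
        have h3 : (A / r ^ N) ^ p * (unitBallVolume N * r ^ N) =
            A ^ p * unitBallVolume N * s ^ (-α) := by
          -- The only place where the value p = 1 + 2/N matters: r^{Np} exceeds the volume factor
          -- r^N by exactly r² = s^α.
          have h4 : (r ^ N) ^ p = r ^ N * s ^ α := by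
            rw [hp, fujitaExponent, Real.rpow_add (by positivity), Real.rpow_one,
              pow_rpow_two_div hN hr0.le, rpow_half_sq hs0.le]
          rw [Real.div_rpow hA (by positivity), h4, Real.rpow_neg hs0.le]
          field_simp
        rw [h3] at h1
        have h5 := h2.trans' (mul_le_mul_right h1 _)
        refine (mul_le_mul_right h5 _).trans' ?_
        rw [← ENNReal.ofReal_mul hW0, ← ENNReal.ofReal_mul (by positivity),
          ← ENNReal.ofReal_mul (by positivity)]
        apply ENNReal.ofReal_le_ofReal
        have h6 : t ^ (α - 1) ≤ (t - s) ^ (α - 1) :=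
          Real.rpow_le_rpow_of_nonpos hts (by linarith) (by linarith)
        have h7 : κ ≤ a * c * gaussConst N a b * unitBallVolume N := by
          rw [hκdef]; unfold ampConst
          rw [one_mul]
          exact div_le_self (by positivity) (one_le_pow₀ (by norm_num))
        calc W * s ^ (-α) = t ^ (α - 1) * (κ * (A ^ p / R ^ N * s ^ (-α))) := by rw [hW]; ring
          _ ≤ (t - s) ^ (α - 1) * (a * c * gaussConst N a b * unitBallVolume N *
              (A ^ p / R ^ N * s ^ (-α))) := by gcongr
          _ = _ := by ring
    _ ≤ _ := by
        gcongr ENNReal.ofReal α * ?_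
        exact lintegral_mono_set (Ioo_subset_Ioo ht'.le (by linarith))

/-- On the cylinder (T/2, T) × B(z,(T/2)^{α/2}) the profile is at least A T^{-αN/2}, and
`IsSolution.ball_bound` applies; the powers of T cancel. -/
lemma IsSolution.selfSimilar_bound (hu : IsSolution α (fujitaExponent N) T μ u)
    (h : WrightMass α a b c) (hN : 1 ≤ N) (hα₀ : 0 < α₀) (hα : α₀ ≤ α) (hα1 : α < 1) (hT : 0 < T)
    {A t' : ℝ} (hA : 0 ≤ A) (ht' : t' ≤ T / 2) (H : SelfSimilarLower u z α T A t') :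
    A ^ (2 / (N : ℝ)) ≤ 2 * (4 * 2 ^ (1 / (fujitaExponent N - 1))) / ampConst N α₀ a b c := by
  have hα0 : 0 < α := hα₀.trans_le hα
  have hN0 : (0 : ℝ) < N := by exact_mod_cast hN
  have hp : 1 < fujitaExponent N := one_lt_fujitaExponent hN
  have hκ0 := ampConst_pos N h hα₀
  have hδ : T - T / 2 = T / 2 := by ring
  have H' : ∀ᵐ t ∂(volume.restrict (Ioo (T / 2) T)),
      ∀ᵐ x ∂(volume.restrict (Metric.ball z ((T / 2) ^ (α / 2)))),
        ENNReal.ofReal (A / (T ^ (α / 2)) ^ N) ≤ u t x := by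
    filter_upwards [ae_restrict_of_ae_restrict_of_subset (Ioo_subset_Ioo_left ht') H,
      ae_restrict_mem measurableSet_Ioo] with t ht1 ht
    have ht0 : 0 < t := by linarith [ht.1]
    filter_upwards [ae_restrict_of_ae_restrict_of_subset (Metric.ball_subset_ball
      (Real.rpow_le_rpow (by positivity) ht.1.le (by positivity))) ht1] with x hx
    refine le_trans (ENNReal.ofReal_le_ofReal ?_) hx
    have : t ^ (α / 2) ≤ T ^ (α / 2) := Real.rpow_le_rpow ht0.le ht.2.le (by positivity)
    gcongr
  have key := hu.ball_bound h hα₀ hα hα1 hp (by positivity) (by positivity) le_rfl (by linarith)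
    (by positivity) (by rw [hδ, rpow_half_sq (by positivity)]) H'
  rw [fujitaExponent_sub_one] at key ⊢
  rw [hδ, Real.div_rpow hA (by positivity), pow_rpow_two_div hN (by positivity),
    rpow_half_sq hT.le] at key
  rw [le_div_iff₀ hκ0]
  have hTα : 0 < T ^ α := by positivity
  have h1 := half_rpow_ge hT.le hα1
  have h2 : ampConst N α₀ a b c * (T ^ α / 2) * (A ^ (2 / (N : ℝ)) / T ^ α) =
      ampConst N α₀ a b c * A ^ (2 / (N : ℝ)) / 2 := by field_simp
  have h3 : ampConst N α₀ a b c * (T ^ α / 2) * (A ^ (2 / (N : ℝ)) / T ^ α) ≤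
      ampConst N α₀ a b c * (T / 2) ^ α * (A ^ (2 / (N : ℝ)) / T ^ α) := by gcongr
  linarith

/-- Keeps the estimates uniform as q = 1 - α → 0: after division by q, a fixed factor in time costs
only a logarithm. -/
lemma one_sub_mul_log_le_rpow_neg {x q : ℝ} (hx : 0 < x) : 1 - q * Real.log x ≤ x ^ (-q) := by
  rw [Real.rpow_def_of_pos hx]
  linarith [Real.add_one_le_exp (Real.log x * -q)]

/-- In the critical case a self-similar lower bound on a long time interval forces the
coefficient to be small. -/
lemma IsSolution.critical_bound (hu : IsSolution α (fujitaExponent N) T μ u)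
    (h : WrightMass α a b c) (hN : 1 ≤ N) (hα₀ : 0 < α₀) (hα : α₀ ≤ α) (hα1 : α < 1) (hT : 0 < T)
    {A τ W : ℝ} (hA : 0 < A) (hτ : 0 < τ)
    (hW : W = 2 * (4 * 2 ^ (1 / (fujitaExponent N - 1))) / ampConst N α₀ a b c +
      2 / ampConst N α₀ a b c)
    (H : SelfSimilarLower u z α T A τ) :
    (1 - (2 * τ / T) ^ (1 - α)) / (1 - α) ≤
      W / (A ^ (2 / (N : ℝ)) * (1 - (2 ^ (2 / (N : ℝ)))⁻¹)) := by
  by_contra hcon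
  push Not at hcon
  have hN0 : (0 : ℝ) < N := by exact_mod_cast hN
  set κ := ampConst N α₀ a b c with hκ
  have hκ0 : 0 < κ := ampConst_pos N h hα₀
  set q := 1 - α with hq
  have hq0 : 0 < q := by linarith
  set l : ℝ := 2 ^ (2 / (N : ℝ)) with hl
  have hl1 : 1 < l := Real.one_lt_rpow (by norm_num) (by positivity)
  have hl0 : 0 < l := by linarith
  have hli : l⁻¹ < 1 := inv_lt_one_of_one_lt₀ hl1
  have hW0 : 0 < W := by rw [hW]; positivity
  have hAr : 0 < A ^ (2 / (N : ℝ)) := by positivity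
  set Y := W / (A ^ (2 / (N : ℝ)) * (1 - l⁻¹)) with hY
  have hd : 0 < 1 - l⁻¹ := by linarith
  have hY0 : 0 < Y := by positivity
  rw [lt_div_iff₀ hq0] at hcon
  have hX : 0 < (2 * τ / T) ^ q := by positivity
  -- Here y_k stands for (τ/t_k)^q. Its decrements are geometric because doubling the coefficient A
  -- 2^k needs an integral of size (A 2^k)^{-2/N}; their sum is less than qY, and the negated claim
  -- keeps y_k above (2τ/T)^q, that is, t_k ≤ T/2.
  let y : ℕ → ℝ := fun k => 1 - q * (Y * (1 - l⁻¹ ^ k))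
  have hlk : ∀ k : ℕ, 0 < l⁻¹ ^ k ∧ l⁻¹ ^ k ≤ 1 := fun k =>
    ⟨by positivity, pow_le_one₀ (by positivity) hli.le⟩
  have hyX : ∀ k, (2 * τ / T) ^ q ≤ y k := by
    intro k
    have : 0 < q * Y * l⁻¹ ^ k := by have := (hlk k).1; positivity
    simp only [y]; nlinarith
  have hy0 : ∀ k, 0 < y k := fun k => hX.trans_le (hyX k)
  have hy1 : ∀ k, y k ≤ 1 := by
    intro k
    have h1 : 0 ≤ 1 - l⁻¹ ^ k := by linarith [(hlk k).2]
    have h2 : 0 ≤ q * (Y * (1 - l⁻¹ ^ k)) := by positivity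
    simp only [y]; linarith
  let t : ℕ → ℝ := fun k => τ * (y k) ^ (-(1 / q))
  have ht0 : ∀ k, 0 < t k := fun k => by have := hy0 k; simp only [t]; positivity
  have htq : ∀ k, (t k) ^ q = τ ^ q / y k := by
    intro k
    simp only [t]
    rw [Real.mul_rpow hτ.le (Real.rpow_nonneg (hy0 k).le _), ← Real.rpow_mul (hy0 k).le,
      show -(1 / q) * q = -1 by field_simp, Real.rpow_neg_one, div_eq_mul_inv]
  have hyD : ∀ k, y k - y (k + 1) = q * (W / (A ^ (2 / (N : ℝ)) * l ^ k)) := by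
    intro k
    have h1 : Y * (1 - l⁻¹) = W / A ^ (2 / (N : ℝ)) := by
      rw [hY, ← div_div, div_mul_cancel₀ _ hd.ne']
    calc y k - y (k + 1) = q * (Y * (1 - l⁻¹) * l⁻¹ ^ k) := by simp only [y, pow_succ]; ring
      _ = _ := by rw [h1, inv_pow]; field_simp
  have htmono : ∀ k, t k ≤ t (k + 1) := by
    intro k
    have h1 : y (k + 1) ≤ y k := by
      have : 0 < q * (W / (A ^ (2 / (N : ℝ)) * l ^ k)) := by positivity
      linarith [hyD k]
    simp only [t]
    gcongr ?_ * ?_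
    exact Real.rpow_le_rpow_of_nonpos (hy0 _) h1 (by simp; positivity)
  have htT : ∀ k, t k ≤ T / 2 := by
    intro k
    rw [← Real.rpow_le_rpow_iff (ht0 k).le (by positivity) hq0, htq, div_le_iff₀ (hy0 k)]
    calc τ ^ q = (T / 2) ^ q * (2 * τ / T) ^ q := by
          rw [← Real.mul_rpow (by positivity) (by positivity)]; congr 1; field_simp
      _ ≤ _ := by gcongr; exact hyX k
  have hpow : ∀ k : ℕ, (A * 2 ^ k) ^ (2 / (N : ℝ)) = A ^ (2 / (N : ℝ)) * l ^ k := by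
    intro k
    rw [Real.mul_rpow hA.le (by positivity), hl, ← Real.rpow_natCast, ← Real.rpow_natCast,
      ← Real.rpow_mul (by norm_num), ← Real.rpow_mul (by norm_num), mul_comm (k : ℝ)]
  have hind : ∀ k, SelfSimilarLower u z α T (A * 2 ^ k) (t k) := by
    intro k
    induction k with
    | zero =>
      have : t 0 = τ := by simp [t, y]
      rw [this, pow_zero, mul_one]
      exact H
    | succ k ih =>
      -- The a priori bound is needed inside the induction: it lets the first summand of W absorb
      -- the loss 1 that comes from stopping at s/2, and 2/κ is what remains for doubling.
      have hE := hu.selfSimilar_bound h hN hα₀ hα hα1 hT (by positivity) (htT k) ih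
      refine hu.amplify_selfSimilar h hN hα₀ hα hα1 (by positivity) (ht0 k) (htmono k) ?_ ih
      intro s hs
      have hs0 : 0 < s := (ht0 _).trans hs.1
      have hAk : 0 < A * 2 ^ k := by positivity
      have e1 : s ^ (α - 1) * (((s / 2) ^ q - (t k) ^ q) / q) =
          ((2 : ℝ) ^ (-q) - (t k) ^ q / s ^ q) / q := by
        have hsq : 0 < s ^ q := by positivity
        rw [show α - 1 = -q by ring, Real.rpow_neg hs0.le, Real.div_rpow hs0.le (by norm_num),
          Real.rpow_neg (by norm_num)]
        field_simp
      have e2 : (t k) ^ q / s ^ q ≤ y (k + 1) / y k := by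
        have h1 : (t (k + 1)) ^ q ≤ s ^ q := Real.rpow_le_rpow (ht0 _).le hs.1.le hq0.le
        have h2 : 0 < (t (k + 1)) ^ q := Real.rpow_pos_of_pos (ht0 _) _
        have h3 : 0 ≤ (t k) ^ q := Real.rpow_nonneg (ht0 _).le _
        calc _ ≤ (t k) ^ q / (t (k + 1)) ^ q := by gcongr
          _ = _ := by
            have := hy0 k
            have := hy0 (k + 1)
            rw [htq, htq]; field_simp
      have e3 : 1 - q ≤ (2 : ℝ) ^ (-q) := by
        refine le_trans ?_ (one_sub_mul_log_le_rpow_neg (by norm_num))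
        have : Real.log 2 ≤ 1 := by linarith [Real.log_two_lt_d9]
        nlinarith
      -- Dividing the decrement by y_k ≤ 1 only enlarges it.
      have e4 : q * (W / (A ^ (2 / (N : ℝ)) * l ^ k)) ≤ 1 - y (k + 1) / y k := by
        rw [← hyD k, one_sub_div (hy0 k).ne', le_div_iff₀ (hy0 k)]
        have : 0 ≤ y k - y (k + 1) := by rw [hyD k]; positivity
        nlinarith [hy1 k]
      have e5 : 2 / κ / (A ^ (2 / (N : ℝ)) * l ^ k) ≤
          s ^ (α - 1) * (((s / 2) ^ q - (t k) ^ q) / q) := by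
        rw [e1, le_div_iff₀ hq0]
        rw [hpow k, ← hκ] at hE
        have hAl : 0 < A ^ (2 / (N : ℝ)) * l ^ k := by positivity
        have e6 : 1 + 2 / κ / (A ^ (2 / (N : ℝ)) * l ^ k) ≤ W / (A ^ (2 / (N : ℝ)) * l ^ k) := by
          rw [hW, add_div]
          gcongr
          rwa [one_le_div hAl]
        nlinarith
      have hAp : (A * 2 ^ k) ^ fujitaExponent N =
          (A * 2 ^ k) * (A ^ (2 / (N : ℝ)) * l ^ k) := by
        rw [fujitaExponent, Real.rpow_add hAk, Real.rpow_one, hpow]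
      have hAl : 0 < A ^ (2 / (N : ℝ)) * l ^ k := by positivity
      calc A * 2 ^ (k + 1) = κ * (A * 2 ^ k) ^ fujitaExponent N *
            (2 / κ / (A ^ (2 / (N : ℝ)) * l ^ k)) := by
            rw [hAp]; field_simp; ring
        _ ≤ _ := by gcongr
  have hlim : Tendsto (fun k : ℕ => A ^ (2 / (N : ℝ)) * l ^ k) atTop atTop :=
    (tendsto_pow_atTop_atTop_of_one_lt hl1).const_mul_atTop hAr
  obtain ⟨k, hk⟩ := (hlim.eventually_gt_atTop
    (2 * (4 * 2 ^ (1 / (fujitaExponent N - 1))) / ampConst N α₀ a b c)).exists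
  have := hu.selfSimilar_bound h hN hα₀ hα hα1 hT (by positivity) (htT k) (hind k)
  rw [hpow] at this
  linarith

end Critical

/-- Logarithmic bound for the initial measure in the critical case, with a constant depending on
`α` only through `WrightMass`. -/
lemma exists_critical_growth_bound (N : ℕ) (hN : 1 ≤ N) {α₀ a b c : ℝ} (hα₀ : 0 < α₀)
    (hb : 0 < b) (ha : 0 < a) (hc : 0 < c) :
    ∃ γ : ℝ, 0 < γ ∧ ∀ α, α₀ ≤ α → α < 1 → WrightMass α a b c → ∀ T : ℝ, 0 < T →
      ∀ μ : Measure (EuclideanSpace ℝ (Fin N)), IsLocallyFiniteMeasure μ →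
        (∃ u, IsSolution α (fujitaExponent N) T μ u) → ∀ σ ∈ Ioc (0 : ℝ) (T ^ (α / 2)), ∀ z,
          (μ (Metric.ball z σ)).toReal ≤ γ *
            (∫ t in (σ ^ (2 / α) / (16 * T))..(1 / 4), t ^ (-α)) ^ (-((N : ℝ) / 2)) := by
  have hN0 : (0 : ℝ) < N := by exact_mod_cast hN
  have hp : 1 < fujitaExponent N := one_lt_fujitaExponent hN
  obtain ⟨γ₁, hγ₁, hgrowth⟩ := exists_growth_bound N hp hα₀ hb ha hc
  set g := gaussConst N a b with hg
  have hg0 : 0 < g := gaussConst_pos N hb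
  set κ := ampConst N α₀ a b c with hκ
  have hκ0 : 0 < κ := by
    have := unitBallVolume_pos N
    rw [hκ]; unfold ampConst; positivity
  set W := 2 * (4 * 2 ^ (1 / (fujitaExponent N - 1))) / κ + 2 / κ with hW
  have hW0 : 0 < W := by positivity
  set d : ℝ := 1 - (2 ^ (2 / (N : ℝ)))⁻¹ with hd
  have hd0 : 0 < d := by
    have : (1 : ℝ) < 2 ^ (2 / (N : ℝ)) := Real.one_lt_rpow (by norm_num) (by positivity)
    linarith [inv_lt_one_of_one_lt₀ this]
  have hlog : 0 < Real.log 32 := Real.log_pos (by norm_num)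
  -- The second summand pays for changing integration limits. It is finite because at the critical
  -- exponent the growth bound reads M ≤ γ₁, with σ to the power 0.
  set V := W / ((c * g) ^ (2 / (N : ℝ)) * d) + 2 * Real.log 32 * γ₁ ^ (2 / (N : ℝ)) with hV
  have hV0 : 0 < V := by positivity
  refine ⟨V ^ ((N : ℝ) / 2), by positivity, ?_⟩
  rintro α hα hα1 h T hT μ hμ ⟨u, hu⟩ σ hσ' z
  have hMγ := hgrowth α hα hα1 h T hT μ hμ ⟨u, hu⟩ σ hσ' z
  obtain ⟨hσ, hσT⟩ := hσ'
  have hα0 : 0 < α := hα₀.trans_le hα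
  set τ := σ ^ (2 / α) with hτ
  have hτ0 : 0 < τ := by positivity
  have hτσ : τ ^ (α / 2) = σ := by
    rw [hτ, ← Real.rpow_mul hσ.le, show 2 / α * (α / 2) = 1 by field_simp, Real.rpow_one]
  have hτT : τ ≤ T := by
    have h1 : σ ^ (2 / α) ≤ (T ^ (α / 2)) ^ (2 / α) := Real.rpow_le_rpow hσ.le hσT (by positivity)
    rw [← Real.rpow_mul hT.le, show α / 2 * (2 / α) = 1 by field_simp, Real.rpow_one] at h1
    exact h1
  set M := (μ (Metric.ball z σ)).toReal with hM
  have hM0 : 0 ≤ M := ENNReal.toReal_nonneg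
  have hMμ : ENNReal.ofReal M = μ (Metric.ball z σ) := ENNReal.ofReal_toReal measure_ball_lt_top.ne
  have hMγ' : M ≤ γ₁ := by
    rw [fujitaExponent_sub_one, show (N : ℝ) - 2 / (2 / (N : ℝ)) = 0 by field_simp; ring,
      Real.rpow_zero, mul_one] at hMγ
    exact hMγ
  set q := 1 - α with hq
  have hq0 : 0 < q := by linarith
  have hI : ∫ t in (τ / (16 * T))..(1 / 4), t ^ (-α) =
      ((1 / 4 : ℝ) ^ q - (τ / (16 * T)) ^ q) / q := by
    rw [integral_rpow (Or.inl (by linarith)), show -α + 1 = q by rw [hq]; ring]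
  have hx : τ / (16 * T) < 1 / 4 := by
    rw [div_lt_iff₀ (by positivity)]; linarith
  have hIpos : 0 < ∫ t in (τ / (16 * T))..(1 / 4), t ^ (-α) := by
    rw [hI]
    have := Real.rpow_lt_rpow (by positivity) hx hq0
    exact div_pos (by linarith) hq0
  set I := ∫ t in (τ / (16 * T))..(1 / 4), t ^ (-α) with hIdef
  rcases hM0.eq_or_lt with hM1 | hM1
  · rw [← hM1]; positivity
  have H : SelfSimilarLower u z α T (c * g * M) τ := by
    have hsub : Ioo τ T ⊆ Ioc 0 T := fun t ht => ⟨hτ0.trans ht.1, ht.2.le⟩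
    unfold SelfSimilarLower
    filter_upwards [ae_restrict_of_ae_restrict_of_subset hsub hu.opP_le,
      ae_restrict_mem measurableSet_Ioo] with t htu ht
    filter_upwards [ae_restrict_of_ae htu, ae_restrict_mem measurableSet_ball] with x hxu hx
    refine le_trans ?_ hxu
    have ht0 : 0 < t := hτ0.trans ht.1
    rw [mul_div_right_comm, ENNReal.ofReal_mul (by positivity), hMμ]
    have hR2 := rpow_half_sq ht0.le α
    refine opP_lower h (by positivity) ?_ hR2.ge μ measurableSet_ball ?_
    · rw [hR2]; linarith [Real.rpow_pos_of_pos ht0 α]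
    · intro y hy
      rw [← dist_eq_norm]
      have h1 := Metric.mem_ball.1 hx
      have h2 := Metric.mem_ball'.1 hy
      have h3 : σ ≤ t ^ (α / 2) := by
        rw [← hτσ]; exact Real.rpow_le_rpow hτ0.le ht.1.le (by positivity)
      linarith [dist_triangle x z y]
  have hcrit := hu.critical_bound h hN hα₀ hα hα1 hT (by positivity) hτ0 hW H
  rw [← hq, ← hd, Real.mul_rpow (by positivity) hM0] at hcrit
  set m := M ^ (2 / (N : ℝ)) with hm
  have hm0 : 0 < m := by positivity
  have hmγ : m ≤ γ₁ ^ (2 / (N : ℝ)) := Real.rpow_le_rpow hM0 hMγ' (by positivity)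
  have hIle : I ≤ W / ((c * g) ^ (2 / (N : ℝ)) * m * d) + 2 * Real.log 32 := by
    have h1 : (1 / 4 : ℝ) ^ q ≤ 1 := Real.rpow_le_one (by norm_num) (by norm_num) hq0.le
    -- The stated lower limit is 2τ/T divided by 32, which adds at most 2 log 32 to the integral.
    have h2 : (τ / (16 * T)) ^ q = (2 * τ / T) ^ q * 32 ^ (-q) := by
      rw [Real.rpow_neg (by norm_num), ← Real.inv_rpow (by norm_num),
        ← Real.mul_rpow (by positivity) (by positivity)]
      congr 1
      field_simp
      norm_num
    have h3 := one_sub_mul_log_le_rpow_neg (x := 32) (q := q) (by norm_num)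
    have h4 : (2 * τ / T) ^ q ≤ 2 := by
      calc (2 * τ / T) ^ q ≤ 2 ^ q := by
            refine Real.rpow_le_rpow (by positivity) ?_ hq0.le
            rw [div_le_iff₀ hT]; linarith
        _ ≤ 2 ^ (1 : ℝ) := Real.rpow_le_rpow_of_exponent_le (by norm_num) (by linarith)
        _ = 2 := Real.rpow_one 2
    have h5 : 0 < (2 * τ / T) ^ q := by positivity
    have h6 : (1 - (2 * τ / T) ^ q) ≤ W / ((c * g) ^ (2 / (N : ℝ)) * m * d) * q :=
      (div_le_iff₀ hq0).1 hcrit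
    rw [hI, div_le_iff₀ hq0, h2]
    have h7 : (2 * τ / T) ^ q * (1 - q * Real.log 32) ≤ (2 * τ / T) ^ q * 32 ^ (-q) := by gcongr
    have h8 : (2 * τ / T) ^ q * (q * Real.log 32) ≤ 2 * (q * Real.log 32) := by gcongr
    nlinarith
  have hmI : m * I ≤ V := by
    calc m * I ≤ m * (W / ((c * g) ^ (2 / (N : ℝ)) * m * d) + 2 * Real.log 32) := by gcongr
      _ = W / ((c * g) ^ (2 / (N : ℝ)) * d) + 2 * Real.log 32 * m := by field_simp
      _ ≤ V := by rw [hV]; gcongr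
  have hmle : m ≤ V / I := by rwa [le_div_iff₀ hIpos]
  have hfin := Real.rpow_le_rpow hm0.le hmle (by positivity : 0 ≤ (N : ℝ) / 2)
  rw [hm, ← Real.rpow_mul hM0, show 2 / (N : ℝ) * ((N : ℝ) / 2) = 1 by field_simp, Real.rpow_one,
    Real.div_rpow hV0.le hIpos.le] at hfin
  rwa [Real.rpow_neg hIpos.le, ← div_eq_mul_inv]

/-! ### Choice of the constants and conclusion. -/

/-- Pointwise constants that can be chosen uniformly near `α = 1` have a finite positive
limsup. -/
lemma exists_constants_of_eventually {Q : ℝ → ℝ → Prop}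
    (hQ : ∀ α ∈ Ioo (0 : ℝ) 1, ∃ γ, 0 < γ ∧ Q α γ)
    (hev : ∃ γ, 0 < γ ∧ ∀ᶠ α in 𝓝[<] (1 : ℝ), Q α γ) :
    ∃ γ : ℝ → ℝ, (∀ α ∈ Ioo (0 : ℝ) 1, 0 < γ α) ∧
      limsup (fun α => (γ α : EReal)) (𝓝[<] (1 : ℝ)) ∈ Ioo (0 : EReal) ⊤ ∧
      ∀ α ∈ Ioo (0 : ℝ) 1, Q α (γ α) := by
  classical
  obtain ⟨γ₀, hγ₀, hev⟩ := hev
  choose! f hf0 hf using hQ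
  -- Taking γ₀ wherever it works makes the constants equal to γ₀ near 1, so the limsup is γ₀.
  refine ⟨fun α => if Q α γ₀ then γ₀ else f α, ?_, ?_, ?_⟩
  · intro α hα
    dsimp only
    split_ifs
    exacts [hγ₀, hf0 α hα]
  · have : limsup (fun α => (((if Q α γ₀ then γ₀ else f α : ℝ)) : EReal)) (𝓝[<] (1 : ℝ)) =
        limsup (fun _ => (γ₀ : EReal)) (𝓝[<] (1 : ℝ)) := by
      refine limsup_congr ?_
      filter_upwards [hev] with α hα
      rw [if_pos hα]
    rw [this, limsup_const]
    exact ⟨by exact_mod_cast hγ₀, EReal.coe_lt_top γ₀⟩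
  · intro α hα
    dsimp only
    split_ifs with hc
    exacts [hc, hf α hα]

lemma iSup_measure_ball_le {N : ℕ} {μ : Measure (EuclideanSpace ℝ (Fin N))}
    [IsLocallyFiniteMeasure μ] {σ C : ℝ} (h : ∀ z, (μ (Metric.ball z σ)).toReal ≤ C) :
    (⨆ z, μ (Metric.ball z σ)) ≤ ENNReal.ofReal C :=
  iSup_le fun z => (ENNReal.le_ofReal_iff_toReal_le measure_ball_lt_top.ne
    (ENNReal.toReal_nonneg.trans (h z))).2 (h z)

end TimeFractional

theorem theorem1p1 (N : ℕ) (hN : 1 ≤ N) :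
    (∀ p : ℝ, 1 < p →
      ∃ γ₁ : ℝ → ℝ,
        (∀ α ∈ Ioo (0 : ℝ) 1, 0 < γ₁ α) ∧
        limsup (fun α => (γ₁ α : EReal)) (𝓝[<] (1 : ℝ)) ∈ Ioo (0 : EReal) ⊤ ∧
        ∀ α ∈ Ioo (0 : ℝ) 1, ∀ T : ℝ, 0 < T →
          ∀ μ : Measure (EuclideanSpace ℝ (Fin N)), IsLocallyFiniteMeasure μ →
            (∃ u, TimeFractional.IsSolution α p T μ u) →
              ∀ σ ∈ Ioc (0 : ℝ) (T ^ (α / 2)),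
                (⨆ z, μ (Metric.ball z σ)) ≤
                  ENNReal.ofReal (γ₁ α * σ ^ ((N : ℝ) - 2 / (p - 1)))) ∧
    (∃ γ₁' : ℝ → ℝ,
        (∀ α ∈ Ioo (0 : ℝ) 1, 0 < γ₁' α) ∧
        limsup (fun α => (γ₁' α : EReal)) (𝓝[<] (1 : ℝ)) ∈ Ioo (0 : EReal) ⊤ ∧
        ∀ α ∈ Ioo (0 : ℝ) 1, ∀ T : ℝ, 0 < T →
          ∀ μ : Measure (EuclideanSpace ℝ (Fin N)), IsLocallyFiniteMeasure μ →
            (∃ u, TimeFractional.IsSolution α (TimeFractional.fujitaExponent N) T μ u) →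
              ∀ σ ∈ Ioc (0 : ℝ) (T ^ (α / 2)),
                (⨆ z, μ (Metric.ball z σ)) ≤
                  ENNReal.ofReal (γ₁' α *
                    (∫ t in (σ ^ (2 / α) / (16 * T))..(1 / 4), t ^ (-α)) ^ (-((N : ℝ) / 2)))) := by
  refine ⟨fun p hp => ?_, ?_⟩
  · refine TimeFractional.exists_constants_of_eventually (Q := fun α γ => ∀ T : ℝ, 0 < T →
      ∀ μ : Measure (EuclideanSpace ℝ (Fin N)), IsLocallyFiniteMeasure μ →
        (∃ u, TimeFractional.IsSolution α p T μ u) → ∀ σ ∈ Ioc (0 : ℝ) (T ^ (α / 2)),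
          (⨆ z, μ (Metric.ball z σ)) ≤ ENNReal.ofReal (γ * σ ^ ((N : ℝ) - 2 / (p - 1)))) ?_ ?_
    · intro α hα
      obtain ⟨a, b, c, h⟩ := TimeFractional.exists_wrightMass hα
      obtain ⟨γ, hγ, H⟩ := TimeFractional.exists_growth_bound N hp hα.1 h.b_pos h.a_pos h.c_pos
      exact ⟨γ, hγ, fun T hT μ hμ hu σ hσ =>
        TimeFractional.iSup_measure_ball_le (H α le_rfl hα.2 h T hT μ hμ hu σ hσ)⟩
    -- These are the α-independent data of `eventually_wrightMass`, so one constant serves all α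
    -- near 1.
    · obtain ⟨γ, hγ, H⟩ := TimeFractional.exists_growth_bound N hp (α₀ := 1 / 2) (a := 1 / 2)
        (b := 3 / 2) (c := 1 / 2) (by norm_num) (by norm_num) (by norm_num) (by norm_num)
      refine ⟨γ, hγ, ?_⟩
      filter_upwards [TimeFractional.eventually_wrightMass,
        TimeFractional.eventually_mem_Ioo_nhdsLT] with α h hα T hT μ hμ hu σ hσ
      exact TimeFractional.iSup_measure_ball_le (H α hα.1.le hα.2 h T hT μ hμ hu σ hσ)
  · refine TimeFractional.exists_constants_of_eventually (Q := fun α γ => ∀ T : ℝ, 0 < T →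
      ∀ μ : Measure (EuclideanSpace ℝ (Fin N)), IsLocallyFiniteMeasure μ →
        (∃ u, TimeFractional.IsSolution α (TimeFractional.fujitaExponent N) T μ u) →
          ∀ σ ∈ Ioc (0 : ℝ) (T ^ (α / 2)),
            (⨆ z, μ (Metric.ball z σ)) ≤ ENNReal.ofReal (γ *
              (∫ t in (σ ^ (2 / α) / (16 * T))..(1 / 4), t ^ (-α)) ^ (-((N : ℝ) / 2)))) ?_ ?_
    · intro α hα
      obtain ⟨a, b, c, h⟩ := TimeFractional.exists_wrightMass hα
      obtain ⟨γ, hγ, H⟩ := TimeFractional.exists_critical_growth_bound N hN hα.1 h.b_pos h.a_pos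
        h.c_pos
      exact ⟨γ, hγ, fun T hT μ hμ hu σ hσ =>
        TimeFractional.iSup_measure_ball_le (H α le_rfl hα.2 h T hT μ hμ hu σ hσ)⟩
    · obtain ⟨γ, hγ, H⟩ := TimeFractional.exists_critical_growth_bound N hN (α₀ := 1 / 2)
        (a := 1 / 2) (b := 3 / 2) (c := 1 / 2) (by norm_num) (by norm_num) (by norm_num)
        (by norm_num)
      refine ⟨γ, hγ, ?_⟩
      filter_upwards [TimeFractional.eventually_wrightMass,
        TimeFractional.eventually_mem_Ioo_nhdsLT] with α h hα T hT μ hμ hu σ hσ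
      exact TimeFractional.iSup_measure_ball_le (H α hα.1.le hα.2 h T hT μ hμ hu σ hσ)
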